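/- Let $K$ be a field and let $\Lambda=\Lambda(x_i\mid i\ge 0)$ be the Grassmann algebra over $K$ in odd letters $x_0,x_1,x_2,\dots$, with superderivatives $\partial_i$ determined by $\partial_i(x_j)=\delta_{ij}$. Elements of $\Lambda$ act on $\Lambda$ by left multiplication. The pivot elements are the odd superderivations $$v_i=\partial_i+x_ix_{i+1}\bigl(\partial_{i+3}+x_{i+3}x_{i+4}(\partial_{i+6}+x_{i+6}x_{i+7}(\partial_{i+9}+\cdots))\bigr)\in\operatorname{End}_K\Lambda,\qquad i\ge 0,$$ where only finitely many terms act nontrivially on any given element of $\Lambda$. The space $\operatorname{End}_K\Lambda$ is a Lie superalgebra under the supercommutator $[a,b]=ab-(-1)^{|a||b|}ba$. If $\operatorname{char}K=2$, it also carries the quadratic map $a\mapsto a^2$ on odd elements, and subalgebras are required to be closed under it. Let $\mathbf Q=\operatorname{Lie}(v_0,v_1,v_2)$ be the Lie subsuperalgebra generated by $v_0,v_1,v_2$. For an integer $n$ let $r_n$ denote any monomial $x_0^{\xi_0}\cdots x_n^{\xi_n}$ with $\xi_i\in\{0,1\}$, and $r_n=1$ if $n<0$. Let $x_i^*$ denote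 either of $1,x_i$. The standard monomials of the first type are the elements of $$\{r_{n-3}v_n\mid n\ge 0\}\setminus\{x_0x_1^*v_4,\ x_0x_1^*x_2^*x_3x_4^*v_7\}.$$ The standard monomials of the second type are the elements of $$\{x_1v_3,\ x_2v_4,\ x_3v_5\}\cup\Bigl(\{r_{n-5}x_{n-2}v_n\mid n\ge 6\}\setminus\{x_0x_1^*x_2^*x_5v_7,\ x_0x_1^*x_2^*x_3x_4^*x_5x_8v_{10}\}\Bigr).$$ 1. If $\operatorname{char}K\ne 2$, then the standard monomials of the first and second types together form a basis of $\mathbf Q$. 2. If $\operatorname{char}K=2$, then: (a) the standard monomials of the first type form a basis of the ordinary Lie algebra generated by $v_0,v_1,v_2$ (closed under the commutator, not necessarily under squares); (b) $v_{n-3}^2=x_{n-2}v_n$ for all $n\ge 3$, and the standard monomials of the first type together with these squares $x_{n-2}v_n$, $n\ge 3$, form a basis of the Lie superalgebra $\mathbf Q$, and also of the restricted Lie superalgebra and of the restricted Lie algebra $\operatorname{Lie}_p(v_0,v_1,v_2)$, $p=2$, generated by $v_0,v_1,v_2$. In each case the listed monomials, for distinct pairs (set of Grassmann letters, index $n$),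 are pairwise distinct. -/

import Mathlib

namespace FractalQ

noncomputable section

attribute [local instance] LieRing.ofAssociativeRing

/-- The Grassmann algebra `Λ = Λ(x_i | i ≥ 0)`: the exterior algebra of the vector space with
basis indexed by `ℕ`. -/
abbrev Grassmann (K : Type*) [Field K] : Type _ := ExteriorAlgebra K (ℕ →₀ K)

/-- The Grassmann letter `x_i`. -/
def letter (K : Type*) [Field K] (i : ℕ) : Grassmann K :=
  ExteriorAlgebra.ι K (Finsupp.single i (1 : K))

/-- The parity components `Λ_α`, `α ∈ ℤ/2`; all letters are odd. -/
def parityPart (K : Type*) [Field K] (α : ZMod 2) : Submodule K (Grassmann K) :=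
  CliffordAlgebra.evenOdd (0 : QuadraticForm K (ℕ →₀ K)) α

/-- The superderivative `∂_i` of `Λ`, that is, contraction with the `i`-th coordinate functional:
`∂_i (x_j) = δ_{ij}` and `∂_i (x_j f) = δ_{ij} f - x_j ∂_i (f)`. -/
def partialD (K : Type*) [Field K] (i : ℕ) : Module.End K (Grassmann K) :=
  CliffordAlgebra.contractLeft (Q := (0 : QuadraticForm K (ℕ →₀ K)))
    (Finsupp.lapply i : (ℕ →₀ K) →ₗ[K] K)

/-- Only finitely many of the `∂_i` act nontrivially on a given element of `Λ`. -/
theorem finite_partialD_ne_zero (K : Type*) [Field K] (f : Grassmann K) :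
    {i : ℕ | partialD K i f ≠ 0}.Finite := by
  induction f using CliffordAlgebra.left_induction with
  | algebraMap r =>
    convert Set.finite_empty (α := ℕ)
    ext i
    simp [partialD]
  | add x y hx hy =>
    refine (hx.union hy).subset fun i hi => ?_
    by_contra h
    simp only [Set.mem_union, Set.mem_ofPred_eq, not_or, not_not] at h
    exact hi (by rw [map_add, h.1, h.2, add_zero])
  | ι_mul x m hx =>
    refine (hx.union m.support.finite_toSet).subset fun i hi => ?_
    by_contra h
    simp only [Set.mem_union, Set.mem_ofPred_eq, not_or, not_not, Finset.mem_coe,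
      Finsupp.mem_support_iff] at h
    refine hi ?_
    have h1 := h.1
    simp only [partialD] at h1 ⊢
    rw [CliffordAlgebra.contractLeft_ι_mul, h1, Finsupp.lapply_apply, h.2, zero_smul, mul_zero,
      sub_zero]

/-- The coefficient `x_i x_{i+1} x_{i+3} x_{i+4} ⋯ x_{i+3k-3} x_{i+3k-2}` of `∂_{i+3k}` in the
pivot element `v_i`. -/
def pivotCoeff (K : Type*) [Field K] (i : ℕ) : ℕ → Grassmann K
  | 0 => 1
  | k + 1 => pivotCoeff K i k * (letter K (i + 3 * k) * letter K (i + 3 * k + 1))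

theorem finite_support_pivot (K : Type*) [Field K] (i : ℕ) (f : Grassmann K) :
    (Function.support fun k : ℕ => pivotCoeff K i k * partialD K (i + 3 * k) f).Finite := by
  have h : Function.Injective fun k : ℕ => i + 3 * k := fun a b hab => by
    simp only at hab
    omega
  refine ((finite_partialD_ne_zero K f).preimage h.injOn).subset fun k hk hk' => hk ?_
  simp only [hk', mul_zero]

/-- The pivot element
`v_i = ∂_i + x_i x_{i+1} (∂_{i+3} + x_{i+3} x_{i+4} (∂_{i+6} + ⋯))`
as an endomorphism of `Λ`. The sum `∑_k x_i x_{i+1} ⋯ x_{i+3k-3} x_{i+3k-2} ∂_{i+3k}` is infinite,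
but only finitely many of its terms act nontrivially on a given element of `Λ`. -/
def pivot (K : Type*) [Field K] (i : ℕ) : Module.End K (Grassmann K) where
  toFun f := ∑ᶠ k : ℕ, pivotCoeff K i k * partialD K (i + 3 * k) f
  map_add' f g := by
    rw [← finsum_add_distrib (finite_support_pivot K i f) (finite_support_pivot K i g)]
    simp only [map_add, mul_add]
  map_smul' c f := by
    rw [RingHom.id_apply, smul_finsum]
    simp only [map_smul, mul_smul_comm]

/-- An endomorphism `a` of `Λ` is homogeneous of parity `α` if `a (Λ_β) ⊆ Λ_{α+β}`
for all `β ∈ ℤ/2`. -/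
def IsHomogeneous (K : Type*) [Field K] (α : ZMod 2) (a : Module.End K (Grassmann K)) : Prop :=
  ∀ β : ZMod 2, ∀ f ∈ parityPart K β, a f ∈ parityPart K (α + β)

/-- The supercommutator `[a, b] = a b - (-1)^{αβ} b a` of endomorphisms `a`, `b` of parities
`α`, `β`. -/
def superBracket {K : Type*} [Field K] (α β : ZMod 2) (a b : Module.End K (Grassmann K)) :
    Module.End K (Grassmann K) :=
  a * b - (-1 : K) ^ (α.val * β.val) • (b * a)

/-- Subalgebras of the Lie superalgebra `(End Λ)^(-)`: graded subspaces closed under the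
supercommutator and, in characteristic two, under the quadratic mapping `a ↦ a²` on the odd part. -/
structure IsLieSubsuperalgebra {K : Type*} [Field K]
    (S : Submodule K (Module.End K (Grassmann K))) : Prop where
  graded : ∀ a ∈ S, ∃ a₀ ∈ S, ∃ a₁ ∈ S, IsHomogeneous K 0 a₀ ∧ IsHomogeneous K 1 a₁ ∧ a = a₀ + a₁
  bracket : ∀ (α β : ZMod 2), ∀ a ∈ S, ∀ b ∈ S, IsHomogeneous K α a → IsHomogeneous K β b →
    superBracket α β a b ∈ S
  square : ringChar K = 2 → ∀ a ∈ S, IsHomogeneous K 1 a → a * a ∈ S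

/-- Restricted subalgebras of the Lie superalgebra `(End Λ)^(-)` in characteristic `p`: moreover,
the even part is closed under the `p`-mapping `a ↦ a^p`. -/
structure IsRestrictedLieSubsuperalgebra {K : Type*} [Field K] (p : ℕ)
    (S : Submodule K (Module.End K (Grassmann K))) : Prop extends IsLieSubsuperalgebra S where
  pow_mem : ∀ a ∈ S, IsHomogeneous K 0 a → a ^ p ∈ S

/-- Restricted Lie subalgebras of the Lie algebra `(End Λ)^(-)` in characteristic `p`. -/
structure IsRestrictedLieSubalgebra {K : Type*} [Field K] (p : ℕ)
    (S : Submodule K (Module.End K (Grassmann K))) : Prop where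
  lie_mem : ∀ a ∈ S, ∀ b ∈ S, ⁅a, b⁆ ∈ S
  pow_mem : ∀ a ∈ S, a ^ p ∈ S

/-- The set of generators `{v_0, v_1, v_2}`. -/
def generators (K : Type*) [Field K] : Set (Module.End K (Grassmann K)) :=
  {pivot K 0, pivot K 1, pivot K 2}

/-- The Lie superalgebra `Q = Lie(v_0, v_1, v_2)`. -/
def lieSuperQ (K : Type*) [Field K] : Submodule K (Module.End K (Grassmann K)) :=
  sInf {S | generators K ⊆ S ∧ IsLieSubsuperalgebra S}

/-- The ordinary Lie algebra generated by `{v_0, v_1, v_2}` (for fields of characteristic two,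
where the commutator and the supercommutator coincide). -/
def lieQ (K : Type*) [Field K] : Submodule K (Module.End K (Grassmann K)) :=
  (LieSubalgebra.lieSpan K (Module.End K (Grassmann K)) (generators K)).toSubmodule

/-- The restricted Lie superalgebra `Lie_p(v_0, v_1, v_2)`. -/
def restrictedLieSuperQ (K : Type*) [Field K] (p : ℕ) :
    Submodule K (Module.End K (Grassmann K)) :=
  sInf {S | generators K ⊆ S ∧ IsRestrictedLieSubsuperalgebra p S}

/-- The restricted Lie algebra `Lie_p(v_0, v_1, v_2)`. -/
def restrictedLieQ (K : Type*) [Field K] (p : ℕ) : Submodule K (Module.End K (Grassmann K)) :=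
  sInf {S | generators K ⊆ S ∧ IsRestrictedLieSubalgebra p S}

/-- The Grassmann monomial `x_{i_1} ⋯ x_{i_t}` for `A = {i_1 < ⋯ < i_t}`. -/
def monomial (K : Type*) [Field K] (A : Finset ℕ) : Grassmann K :=
  ((A.sort (· ≤ ·)).map (letter K)).prod

/-- For `m = (A, n)`, the operator `x_{i_1} ⋯ x_{i_t} v_n`, where `A = {i_1 < ⋯ < i_t}`
(Grassmann letters act by left multiplication). -/
def lieMonomial (K : Type*) [Field K] (m : Finset ℕ × ℕ) : Module.End K (Grassmann K) :=
  LinearMap.mulLeft K (monomial K m.1) ∘ₗ pivot K m.2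

/-- The false monomials of the first type: `x_0 x_1^* v_4` and `x_0 x_1^* x_2^* x_3 x_4^* v_7`. -/
def falseFirst : Set (Finset ℕ × ℕ) :=
  {m | m.2 = 4 ∧ m.1 ⊆ Finset.range 2 ∧ 0 ∈ m.1} ∪
  {m | m.2 = 7 ∧ m.1 ⊆ Finset.range 5 ∧ 0 ∈ m.1 ∧ 3 ∈ m.1}

/-- The standard monomials of the first type `r_{n-3} v_n`, `n ≥ 0`: the tail `r_{n-3}` is a
product of distinct letters among `x_0, …, x_{n-3}`, and it is `1` for `n < 3`. -/
def standardFirst : Set (Finset ℕ × ℕ) :=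
  {m | ∀ i ∈ m.1, i + 3 ≤ m.2} \ falseFirst

/-- The false monomials of the second type of length at least six:
`x_0 x_1^* x_2^* x_5 v_7` and `x_0 x_1^* x_2^* x_3 x_4^* x_5 x_8 v_{10}`. -/
def falseSecond : Set (Finset ℕ × ℕ) :=
  {m | m.2 = 7 ∧ ∃ B ⊆ Finset.range 3, 0 ∈ B ∧ m.1 = insert 5 B} ∪
  {m | m.2 = 10 ∧ ∃ B ⊆ Finset.range 6, 0 ∈ B ∧ 3 ∈ B ∧ 5 ∈ B ∧ m.1 = insert 8 B}

/-- The standard monomials of the second type: `x_1 v_3`, `x_2 v_4`, `x_3 v_5`, and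
`r_{n-5} x_{n-2} v_n`, `n ≥ 6`, that are not false. -/
def standardSecond : Set (Finset ℕ × ℕ) :=
  {({1}, 3), ({2}, 4), ({3}, 5)} ∪
  ({m | 6 ≤ m.2 ∧ ∃ B : Finset ℕ, (∀ i ∈ B, i + 5 ≤ m.2) ∧ m.1 = insert (m.2 - 2) B} \ falseSecond)

/-- The squares of the pivot elements `x_{n-2} v_n`, `n ≥ 3`. -/
def pivotSquares : Set (Finset ℕ × ℕ) :=
  {m | 3 ≤ m.2 ∧ m.1 = {m.2 - 2}}

/-- The monomials `lieMonomial K m`, `m ∈ I`, are pairwise distinct and form a basis of the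
subspace `S`. -/
def IsMonomialBasis (K : Type*) [Field K] (I : Set (Finset ℕ × ℕ))
    (S : Submodule K (Module.End K (Grassmann K))) : Prop :=
  ∃ b : Module.Basis I K S, ∀ m : I, (b m : Module.End K (Grassmann K)) = lieMonomial K m

end

end FractalQ

/-!
The theorem has three ingredients: the operators `x^A v_n` are linearly independent, the spans in
question are closed under the operations, and all listed monomials are generated.

*Independence.* Evaluated at letters, the family of all `x^A v_n` is triangular: `v_n` maps `x_n`
to `1` and `x_m` to `0` for `m < n`, and the monomials `x^A` form a basis of the Grassmann algebra
(`linearIndependent_lieMonomial`). So each assertion reduces to the equality of the algebra with the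
span of the listed monomials.

*Multiplication.* Since `v_n = ∂_n + x_n x_{n+1} v_{n+3}` is an odd superderivation, one obtains,
for `p = n + 3k` and `c = x_n x_{n+1} x_{n+3} x_{n+4} ⋯ x_{p-3} x_{p-2}`, the anticommutators
`{v_n, v_p} = 2 c x_{p+1} v_{p+3}`, `{v_n, v_{p+1}} = -c x_p v_{p+3}` and
`{v_n, v_{p+2}} = -c x_p x_{p+1} x_{p+2} v_{p+5}` (`anticomm_add_zero`, `anticomm_add_one`,
`anticomm_add_two`). The supercommutator of `x^A v_n` and `x^B v_m` is, up to signs,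
`x^A v_n(x^B) v_m + x^B v_m(x^A) v_n + x^A x^B {v_n, v_m}` (`exists_superBracket_lieMonomial`), and
each of the three terms is a combination of monomials.

*Closure.* The indices that occur are again standard: differentiation keeps the type of a standard
monomial or turns the second type into the first, and the three kinds of anticommutators produce the
second, the first and the first type. For the false monomials this is a finite check with
`n = 4, 5, 7, 10`. The second type arises only with the coefficient `2`, or by squaring, which
explains the difference between the characteristics. In characteristic two, squares of sums reduce
to squares of monomials and commutators, and the square of a monomial vanishes unless it is a pivot
element.

*Generation.* `[v_n, v_{n+1}] = -x_n v_{n+3}` and `[v_n, x_n v_{n+3}] = v_{n+3}` give all pivot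
elements, and the supercommutator with `v_j` removes the letter `x_j` from a tail
(`IsBracketClosed.lieMonomial_erase`), so that only maximal tails have to be produced
(`IsBracketClosed.lieMonomial_range`). Monomials of the second type are supercommutators of two
monomials with the same pivot element, over which the letters are distributed so that neither factor
is false.
-/

namespace FractalQ

noncomputable section

attribute [local instance] LieRing.ofAssociativeRing

variable {K : Type*} [Field K]

/-! ### Grassmann monomials -/

theorem monomial_eq_basis (A : Finset ℕ) :
    monomial K A = (Finsupp.basisSingleOne (R := K) (ι := ℕ)).ExteriorAlgebra A := by
  rw [ExteriorAlgebra.basis_apply_ofCard _ rfl, ExteriorAlgebra.ιMulti_family,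
    ExteriorAlgebra.ιMulti_apply, monomial, ← Finset.listMap_orderEmbOfFin_finRange A rfl,
    List.map_map, List.ofFn_eq_map]
  congr 2

theorem monomial_mul_of_not_disjoint {A B : Finset ℕ} (h : ¬Disjoint A B) :
    monomial K A * monomial K B = 0 := by
  rw [monomial_eq_basis, monomial_eq_basis]
  exact ExteriorAlgebra.basis_mul_of_not_disjoint (m := A.card) (n := B.card) _
    (Set.powersetCard.ofCard rfl) (Set.powersetCard.ofCard rfl) h

theorem exists_monomial_mul {A B : Finset ℕ} (h : Disjoint A B) :
    ∃ ε : ℤˣ, monomial K A * monomial K B = ε • monomial K (A ∪ B) := by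
  simp only [monomial_eq_basis]
  have h' := ExteriorAlgebra.basis_mul_of_disjoint (m := A.card) (n := B.card)
    (Finsupp.basisSingleOne (R := K) (ι := ℕ))
    (Set.powersetCard.ofCard rfl) (Set.powersetCard.ofCard rfl) h
  exact ⟨_, by simpa [Set.powersetCard.disjUnion, Finset.disjUnion_eq_union] using h'⟩

@[simp]
theorem monomial_empty : monomial K ∅ = 1 := by simp [monomial]

@[simp]
theorem monomial_singleton (i : ℕ) : monomial K {i} = letter K i := by simp [monomial]

/-! ### Parity and superderivations -/

/-- The grade involution of `Λ`, which is `1` on even and `-1` on odd elements. -/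
def involute : Grassmann K →ₐ[K] Grassmann K :=
  CliffordAlgebra.involute (Q := (0 : QuadraticForm K (ℕ →₀ K)))

/-- Letters supercommute with all elements. -/
theorem letter_mul (i : ℕ) (f : Grassmann K) : letter K i * f = involute f * letter K i := by
  induction f using CliffordAlgebra.left_induction with
  | algebraMap r => rw [AlgHom.commutes, Algebra.commutes]
  | add f g hf hg => rw [mul_add, map_add, add_mul, hf, hg]
  | ι_mul f v hf =>
    rw [involute, map_mul, CliffordAlgebra.involute_ι, ← involute, mul_assoc, ← hf,
      ← mul_assoc, ← mul_assoc]
    congr 1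
    rw [neg_mul, eq_neg_iff_add_eq_zero]
    exact ExteriorAlgebra.ι_add_mul_swap _ _

theorem letter_mul_self (i : ℕ) : letter K i * letter K i = 0 :=
  ExteriorAlgebra.ι_sq_zero _

theorem involute_involute (f : Grassmann K) : involute (involute f) = f :=
  CliffordAlgebra.involute_involute f

theorem involute_letter (i : ℕ) : involute (letter K i) = -letter K i :=
  CliffordAlgebra.involute_ι _

theorem involute_monomial (A : Finset ℕ) :
    involute (monomial K A) = (-1 : K) ^ A.card • monomial K A := by
  have h (l : List ℕ) : involute (l.map (letter K)).prod =
      (-1 : K) ^ l.length • (l.map (letter K)).prod := by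
    induction l with
    | nil => simp
    | cons i l ih => simp [ih, involute_letter, pow_succ]
  simpa [monomial] using h (A.sort (· ≤ ·))

theorem monomial_mul_comm (A B : Finset ℕ) :
    monomial K A * monomial K B = (-1 : K) ^ (A.card * B.card) • (monomial K B * monomial K A) := by
  have h (l : List ℕ) : (l.map (letter K)).prod * monomial K B =
      (-1 : K) ^ (l.length * B.card) • (monomial K B * (l.map (letter K)).prod) := by
    induction l with
    | nil => simp
    | cons i l ih =>
      rw [List.map_cons, List.prod_cons, mul_assoc, ih, mul_smul_comm, ← mul_assoc, letter_mul,
        involute_monomial, smul_mul_assoc, smul_mul_assoc, smul_smul, ← pow_add, mul_assoc,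
        List.length_cons]
      congr 2
      ring
  simpa [monomial] using h (A.sort (· ≤ ·))

theorem partialD_mul (i : ℕ) (f g : Grassmann K) :
    partialD K i (f * g) = partialD K i f * g + involute f * partialD K i g := by
  induction f using CliffordAlgebra.left_induction generalizing g with
  | algebraMap r =>
    simp [partialD, CliffordAlgebra.contractLeft_algebraMap_mul]
  | add f f' hf hf' => simp only [add_mul, map_add, hf, hf']; abel
  | ι_mul f v hf =>
    simp only [partialD] at hf ⊢
    rw [mul_assoc, CliffordAlgebra.contractLeft_ι_mul, hf, CliffordAlgebra.contractLeft_ι_mul,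
      involute, map_mul, CliffordAlgebra.involute_ι]
    simp only [mul_add, sub_mul, smul_mul_assoc, neg_mul, mul_assoc]
    abel

theorem partialD_letter (i j : ℕ) : partialD K i (letter K j) = if j = i then 1 else 0 := by
  rw [partialD, letter]
  erw [CliffordAlgebra.contractLeft_ι]
  split_ifs with h <;> simp [h]

theorem partialD_comm (i j : ℕ) (f : Grassmann K) :
    partialD K i (partialD K j f) = -partialD K j (partialD K i f) :=
  CliffordAlgebra.contractLeft_comm _ _ _

theorem partialD_partialD (i : ℕ) (f : Grassmann K) : partialD K i (partialD K i f) = 0 :=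
  CliffordAlgebra.contractLeft_contractLeft _ _

theorem letter_mul_letter_mul_comm (i j : ℕ) (f : Grassmann K) :
    letter K i * letter K j * f = f * (letter K i * letter K j) := by
  rw [mul_assoc, letter_mul, letter_mul, map_mul, involute_involute,
    involute_letter, letter_mul]
  simp [involute_letter, mul_assoc, letter_mul j]

theorem pivotCoeff_mul_comm (i k : ℕ) (f : Grassmann K) :
    pivotCoeff K i k * f = f * pivotCoeff K i k := by
  induction k with
  | zero => simp [pivotCoeff]
  | succ k ih => 
    rw [pivotCoeff, mul_assoc, letter_mul_letter_mul_comm, ← mul_assoc, ih, mul_assoc]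

/-- The recursion of `pivotCoeff` at the left end. -/
theorem pivotCoeff_succ' (i k : ℕ) :
    pivotCoeff K i (k + 1) = letter K i * letter K (i + 1) * pivotCoeff K (i + 3) k := by
  induction k with
  | zero => simp [pivotCoeff]
  | succ k ih =>
    rw [pivotCoeff, ih, pivotCoeff, mul_assoc]
    congr 4 <;> ring_nf

theorem pivot_apply (i : ℕ) (f : Grassmann K) :
    pivot K i f = ∑ᶠ k : ℕ, pivotCoeff K i k * partialD K (i + 3 * k) f := rfl

theorem finite_support_mul_pivot (i : ℕ) (a f : Grassmann K) :
    (Function.support fun k : ℕ => a * (pivotCoeff K i k * partialD K (i + 3 * k) f)).Finite :=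
  (finite_support_pivot K i f).subset fun k hk hk' => hk (by simp only [hk', mul_zero])

/-- On a given element, the series defining all pivot elements can be truncated uniformly. -/
theorem exists_pivot_eq_sum (f : Grassmann K) : ∃ N : ℕ, ∀ i, ∀ M ≥ N,
    pivot K i f = ∑ k ∈ Finset.range M, pivotCoeff K i k * partialD K (i + 3 * k) f := by
  obtain ⟨N, hN⟩ := (finite_partialD_ne_zero K f).bddAbove
  refine ⟨N + 1, fun i M hM => finsum_eq_sum_of_support_subset _ fun k hk => ?_⟩
  have h : i + 3 * k ≤ N := hN fun h => hk (by simp only [h, mul_zero])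
  simp only [Finset.coe_range, Set.mem_Iio]
  omega

/-- The pivot elements are odd superderivations. -/
theorem pivot_mul (i : ℕ) (f g : Grassmann K) :
    pivot K i (f * g) = pivot K i f * g + involute f * pivot K i g := by
  simp only [pivot_apply]
  rw [finsum_mul' _ _ (finite_support_pivot K i f), mul_finsum' _ _ (finite_support_pivot K i g),
    ← finsum_add_distrib _ (finite_support_mul_pivot i _ g)]
  · refine finsum_congr fun k => ?_
    rw [partialD_mul, mul_add, ← mul_assoc, ← mul_assoc, ← mul_assoc,
      pivotCoeff_mul_comm i k (involute f)]
  · exact (finite_support_pivot K i f).subset fun k hk hk' => hk (by simp only [hk', zero_mul])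

/-- The self-similarity `v_i = ∂_i + x_i x_{i+1} v_{i+3}`. -/
theorem pivot_eq (i : ℕ) (f : Grassmann K) :
    pivot K i f = partialD K i f + letter K i * letter K (i + 1) * pivot K (i + 3) f := by
  obtain ⟨N, hN⟩ := exists_pivot_eq_sum f
  rw [hN i (N + 1) (by omega), hN (i + 3) N le_rfl, Finset.sum_range_succ', add_comm,
    Finset.mul_sum]
  congr 1
  · simp [pivotCoeff]
  · refine Finset.sum_congr rfl fun k _ => ?_
    rw [pivotCoeff_succ', mul_assoc]
    congr 4
    ring

theorem pivot_letter (i k : ℕ) : pivot K i (letter K (i + 3 * k)) = pivotCoeff K i k := by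
  rw [pivot_apply, finsum_eq_single _ k]
  · simp [partialD_letter]
  · intro l hl
    rw [partialD_letter, if_neg (by omega), mul_zero]

theorem pivot_letter_of_ne (i j : ℕ) (h : ∀ k, j ≠ i + 3 * k) : pivot K i (letter K j) = 0 := by
  rw [pivot_apply]
  exact finsum_eq_zero_of_forall_eq_zero fun k => by rw [partialD_letter, if_neg (h k), mul_zero]

@[simp]
theorem pivot_one (i : ℕ) : pivot K i 1 = 0 := by
  rw [pivot_apply]
  exact finsum_eq_zero_of_forall_eq_zero fun k => by
    rw [partialD, CliffordAlgebra.contractLeft_one, mul_zero]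

/-! ### Anticommutators of the pivot elements -/

theorem involute_letter_mul_letter (i j : ℕ) :
    involute (letter K i * letter K j) = letter K i * letter K j := by
  rw [map_mul, involute_letter, involute_letter, neg_mul_neg]

theorem involute_pivotCoeff (i k : ℕ) : involute (pivotCoeff K i k) = pivotCoeff K i k := by
  induction k with
  | zero => simp [pivotCoeff]
  | succ k ih => simp [pivotCoeff, ih, involute_letter]

theorem partialD_pivotCoeff {n m : ℕ} (h : n < m) (k : ℕ) :
    partialD K n (pivotCoeff K m k) = 0 := by
  induction k with
  | zero =>
    rw [pivotCoeff, partialD, CliffordAlgebra.contractLeft_one]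
  | succ k ih =>
    rw [pivotCoeff, partialD_mul, ih, partialD_mul, partialD_letter, partialD_letter,
      if_neg (by omega), if_neg (by omega)]
    simp

theorem partialD_pivot {n m : ℕ} (h : n < m) (f : Grassmann K) :
    partialD K n (pivot K m f) = -pivot K m (partialD K n f) := by
  obtain ⟨N, hN⟩ := exists_pivot_eq_sum f
  obtain ⟨N', hN'⟩ := exists_pivot_eq_sum (partialD K n f)
  rw [hN m (max N N') (le_max_left _ _), hN' m (max N N') (le_max_right _ _), map_sum,
    ← Finset.sum_neg_distrib]
  refine Finset.sum_congr rfl fun k _ => ?_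
  rw [partialD_mul, partialD_pivotCoeff h, involute_pivotCoeff, zero_mul, zero_add, partialD_comm,
    mul_neg]

theorem pivot_letter_of_lt {n m : ℕ} (h : n < m) : pivot K m (letter K n) = 0 :=
  pivot_letter_of_ne m n fun k => by omega

theorem pivot_letter_self (n : ℕ) : pivot K n (letter K n) = 1 :=
  pivot_letter n 0

/-- The square of a pivot element: `v_n ^ 2 = x_{n+1} v_{n+3}`. -/
theorem pivot_pivot (n : ℕ) (f : Grassmann K) :
    pivot K n (pivot K n f) = letter K (n + 1) * pivot K (n + 3) f := by
  have h0 : letter K n * letter K (n + 1) * (letter K n * letter K (n + 1)) = 0 := by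
    rw [← mul_assoc, letter_mul_letter_mul_comm, ← mul_assoc, letter_mul_self, zero_mul,
      zero_mul]
  have h1 : pivot K (n + 3) (letter K n * letter K (n + 1)) = 0 := by
    rw [pivot_mul, pivot_letter_of_lt (by omega), pivot_letter_of_lt (by omega)]
    simp
  have h2 : partialD K n (letter K n * letter K (n + 1)) = letter K (n + 1) := by
    rw [partialD_mul, partialD_letter, partialD_letter, if_pos rfl, if_neg (by omega)]
    simp
  rw [pivot_eq n (pivot K n f), pivot_eq n f, map_add, map_add, partialD_partialD, partialD_mul,
    h2, pivot_mul, h1, partialD_pivot (by omega), involute_letter_mul_letter, mul_add,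
    mul_add, ← mul_assoc _ (letter K n * letter K (n + 1)), h0]
  simp

/-- The recursion for the anticommutators of pivot elements that follows from
`v_n = ∂_n + x_n x_{n+1} v_{n+3}`, as `∂_n` anticommutes with `v_m` for `n < m`. -/
theorem anticomm_pivot_step {n m : ℕ} (h : n < m) (f : Grassmann K) :
    pivot K n (pivot K m f) + pivot K m (pivot K n f) =
      letter K n * letter K (n + 1) *
        (pivot K (n + 3) (pivot K m f) + pivot K m (pivot K (n + 3) f)) +
      pivot K m (letter K n * letter K (n + 1)) * pivot K (n + 3) f := by
  rw [pivot_eq n, pivot_eq n f, map_add, partialD_pivot h, pivot_mul,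
    involute_letter_mul_letter, mul_add]
  abel

theorem pivot_letter_mul_letter {n m : ℕ} (h : n + 1 < m) :
    pivot K m (letter K n * letter K (n + 1)) = 0 := by
  rw [pivot_mul, pivot_letter_of_lt (by omega), pivot_letter_of_lt (by omega)]
  simp

theorem anticomm_pivot_succ (n : ℕ) (f : Grassmann K) :
    pivot K n (pivot K (n + 1) f) + pivot K (n + 1) (pivot K n f) =
      -(letter K n * pivot K (n + 3) f) := by
  have h : letter K n * letter K (n + 1) * (letter K (n + 1) * letter K (n + 2)) = 0 := by
    rw [mul_assoc, ← mul_assoc (letter K (n + 1)), letter_mul_self, zero_mul, mul_zero]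
  rw [anticomm_pivot_step (by omega), add_comm (pivot K (n + 3) _), anticomm_pivot_step (by omega),
    pivot_letter_mul_letter (by omega), zero_mul, add_zero, ← mul_assoc, h, zero_mul, zero_add,
    pivot_mul, pivot_letter_of_lt (by omega), pivot_letter_self, involute_letter, zero_mul,
    zero_add, mul_one, neg_mul]

theorem anticomm_pivot_add_two (n : ℕ) (f : Grassmann K) :
    pivot K n (pivot K (n + 2) f) + pivot K (n + 2) (pivot K n f) =
      -(letter K n * letter K (n + 1) * letter K (n + 2) * pivot K (n + 5) f) := by
  rw [anticomm_pivot_step (by omega), pivot_letter_mul_letter (by omega), zero_mul, add_zero,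
    add_comm (pivot K (n + 3) _), anticomm_pivot_succ, mul_neg, mul_assoc _ (letter K (n + 2))]

/-- The anticommutator of `v_n` with `v_{n+3k+d}` is that of `v_{n+3k}` with `v_{n+3k+d}`,
multiplied by the coefficient of `∂_{n+3k}` in `v_n`. -/
theorem anticomm_pivot_add_mul (n k d : ℕ) (f g : Grassmann K)
    (h : pivot K (n + 3 * k) (pivot K (n + 3 * k + d) f) +
      pivot K (n + 3 * k + d) (pivot K (n + 3 * k) f) = g) :
    pivot K n (pivot K (n + 3 * k + d) f) + pivot K (n + 3 * k + d) (pivot K n f) =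
      pivotCoeff K n k * g := by
  induction k generalizing n with
  | zero => simpa [pivotCoeff] using h
  | succ k ih =>
    have e : n + 3 * (k + 1) = n + 3 + 3 * k := by ring
    rw [e] at h ⊢
    rw [anticomm_pivot_step (by omega), pivot_letter_mul_letter (by omega), ih _ h, zero_mul,
      add_zero, pivotCoeff_succ', mul_assoc _ _ g]

/-! ### Linear independence -/

/-- The operators `x^A v_n`, over all finite sets `A` and all `n`, are linearly independent: they
are triangular on letters, since `v_m` maps `x_n` to `1` if `m = n` and to `0` if `m > n`. -/
theorem linearIndependent_lieMonomial : LinearIndependent K (lieMonomial K) := by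
  rw [linearIndependent_iff]
  intro l hl
  have key (n : ℕ) : ∀ A, l (A, n) = 0 := by
    induction n using Nat.strong_induction_on with
    | h n ih =>
      intro A
      let b := (Finsupp.basisSingleOne (R := K) (ι := ℕ)).ExteriorAlgebra
      have h := congrArg (fun F : Module.End K (Grassmann K) => b.coord A (F (letter K n))) hl
      simp only [Finsupp.linearCombination_apply, Finsupp.sum, LinearMap.sum_apply, map_sum,
        LinearMap.smul_apply, map_smul, LinearMap.zero_apply, map_zero] at h
      rw [Finset.sum_eq_single (A, n)] at h
      · simpa [lieMonomial, pivot_letter_self, monomial_eq_basis, b] using h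
      · rintro ⟨B, m⟩ - hne
        rcases lt_trichotomy m n with hm | rfl | hm
        · rw [ih m hm, zero_smul]
        · have hB : B ≠ A := fun h => hne (by rw [h])
          simp [lieMonomial, pivot_letter_self, monomial_eq_basis, b, hB]
        · simp [lieMonomial, pivot_letter_of_lt hm]
      · intro hA
        rw [Finsupp.notMem_support_iff.mp hA, zero_smul]
  ext ⟨A, n⟩
  exact key n A

/-- A span of monomials is a monomial basis of itself. -/
theorem isMonomialBasis_of_span_eq {I : Set (Finset ℕ × ℕ)}
    {S : Submodule K (Module.End K (Grassmann K))}
    (h : Submodule.span K (lieMonomial K '' I) = S) : IsMonomialBasis K I S := by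
  subst h
  have hl : LinearIndependent K fun m : I => lieMonomial K (m : Finset ℕ × ℕ) :=
    linearIndependent_lieMonomial.comp _ Subtype.val_injective
  have hr : Set.range (fun m : I => lieMonomial K (m : Finset ℕ × ℕ)) = lieMonomial K '' I := by
    rw [Set.image_eq_range]
  refine ⟨(Module.Basis.span hl).map (LinearEquiv.ofEq _ _ (by rw [hr])), fun m => ?_⟩
  simp [Module.Basis.span_apply]

/-! ### Derivatives of monomials -/

theorem partialD_monomial_of_notMem {j : ℕ} {A : Finset ℕ} (h : j ∉ A) :
    partialD K j (monomial K A) = 0 := by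
  have key (l : List ℕ) (hl : j ∉ l) : partialD K j (l.map (letter K)).prod = 0 := by
    induction l with
    | nil => rw [List.map_nil, List.prod_nil, partialD, CliffordAlgebra.contractLeft_one]
    | cons i l ih =>
      rw [List.mem_cons, not_or] at hl
      rw [List.map_cons, List.prod_cons, partialD_mul, ih hl.2, partialD_letter,
        if_neg (Ne.symm hl.1), zero_mul, mul_zero, add_zero]
  exact key _ (by simpa using h)

theorem exists_monomial_eq_letter_mul {j : ℕ} {A : Finset ℕ} (h : j ∈ A) :
    ∃ ε : ℤˣ, monomial K A = ε • (letter K j * monomial K (A.erase j)) := by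
  obtain ⟨ε, hε⟩ := exists_monomial_mul (K := K) (A := {j}) (B := A.erase j) (by simp)
  refine ⟨ε⁻¹, ?_⟩
  rw [← monomial_singleton, hε, inv_smul_smul, ← Finset.insert_eq, Finset.insert_erase h]

theorem exists_partialD_monomial {j : ℕ} {A : Finset ℕ} (h : j ∈ A) :
    ∃ ε : ℤˣ, partialD K j (monomial K A) = ε • monomial K (A.erase j) := by
  obtain ⟨ε, hε⟩ := exists_monomial_eq_letter_mul (K := K) h
  refine ⟨ε, ?_⟩
  rw [hε, Units.smul_def, Units.smul_def, map_zsmul, partialD_mul, partialD_letter, if_pos rfl,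
    partialD_monomial_of_notMem (Finset.notMem_erase j A), mul_zero, add_zero, one_mul]

/-- On a monomial that contains `x_j`, the superderivation `v_j` merely erases this letter: the other
terms of `v_j` have coefficients divisible by `x_j` and retain the letter, so that they vanish. -/
theorem exists_pivot_monomial {j : ℕ} {A : Finset ℕ} (h : j ∈ A) :
    ∃ ε : ℤˣ, pivot K j (monomial K A) = ε • monomial K (A.erase j) := by
  obtain ⟨ε, hε⟩ := exists_monomial_eq_letter_mul (K := K) h
  refine ⟨ε, ?_⟩
  rw [hε, Units.smul_def, Units.smul_def, map_zsmul, pivot_mul, pivot_letter_self, pivot_eq,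
    partialD_monomial_of_notMem (Finset.notMem_erase j A), zero_add, involute_letter, neg_mul,
    ← mul_assoc, ← mul_assoc, letter_mul_self, zero_mul, zero_mul, neg_zero, add_zero, one_mul]

theorem pivot_monomial_of_lt {n : ℕ} {A : Finset ℕ} (h : ∀ i ∈ A, i < n) :
    pivot K n (monomial K A) = 0 := by
  rw [pivot_apply]
  refine finsum_eq_zero_of_forall_eq_zero fun k => ?_
  rw [partialD_monomial_of_notMem (fun hk => absurd (h _ hk) (by omega)), mul_zero]

/-- The set of letters `x_n, x_{n+1}, x_{n+3}, x_{n+4}, …, x_{n+3k-3}, x_{n+3k-2}` of the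
coefficient of `∂_{n+3k}` in `v_n`. -/
def coeffLetters (n : ℕ) : ℕ → Finset ℕ
  | 0 => ∅
  | k + 1 => coeffLetters n k ∪ {n + 3 * k, n + 3 * k + 1}

theorem mem_coeffLetters {n k i : ℕ} : i ∈ coeffLetters n k ↔
    ∃ l < k, i = n + 3 * l ∨ i = n + 3 * l + 1 := by
  induction k with
  | zero => simp [coeffLetters]
  | succ k ih =>
    simp only [coeffLetters, Finset.mem_union, ih, Finset.mem_insert, Finset.mem_singleton]
    constructor
    · rintro (⟨l, hl, h⟩ | h)
      · exact ⟨l, by omega, h⟩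
      · exact ⟨k, by omega, h⟩
    · rintro ⟨l, hl, h⟩
      rcases Nat.lt_succ_iff_lt_or_eq.mp hl with hl | rfl
      · exact Or.inl ⟨l, hl, h⟩
      · exact Or.inr h

theorem exists_letter_mul_letter {i j : ℕ} (h : i ≠ j) :
    ∃ ε : ℤˣ, letter K i * letter K j = ε • monomial K {i, j} := by
  obtain ⟨ε, hε⟩ := exists_monomial_mul (K := K) (A := {i}) (B := {j}) (by simpa using h)
  rw [monomial_singleton, monomial_singleton, ← Finset.insert_eq] at hε
  exact ⟨ε, hε⟩

theorem exists_pivotCoeff (n k : ℕ) :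
    ∃ ε : ℤˣ, pivotCoeff K n k = ε • monomial K (coeffLetters n k) := by
  induction k with
  | zero => exact ⟨1, by simp [pivotCoeff, coeffLetters]⟩
  | succ k ih =>
    obtain ⟨ε, hε⟩ := ih
    obtain ⟨δ, hδ⟩ := exists_letter_mul_letter (K := K) (i := n + 3 * k) (j := n + 3 * k + 1)
      (by omega)
    obtain ⟨η, hη⟩ := exists_monomial_mul (K := K) (A := coeffLetters n k)
      (B := {n + 3 * k, n + 3 * k + 1}) (by
        rw [Finset.disjoint_left]
        intro i hi
        rw [mem_coeffLetters] at hi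
        simp only [Finset.mem_insert, Finset.mem_singleton]
        omega)
    refine ⟨ε * δ * η, ?_⟩
    rw [pivotCoeff, hε, hδ, smul_mul_smul_comm, hη, smul_smul, coeffLetters]

theorem units_smul_mem {M : Type*} [AddCommGroup M] [Module K M] {T : Submodule K M} {f : M}
    (ε : ℤˣ) (hf : f ∈ T) : ε • f ∈ T := by
  rw [Units.smul_def]
  exact T.toAddSubgroup.zsmul_mem hf _

theorem monomial_mul_mem {T : Submodule K (Grassmann K)} {A B : Finset ℕ}
    (h : Disjoint A B → monomial K (A ∪ B) ∈ T) : monomial K A * monomial K B ∈ T := by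
  by_cases hd : Disjoint A B
  · obtain ⟨ε, hε⟩ := exists_monomial_mul (K := K) hd
    rw [hε]
    exact units_smul_mem ε (h hd)
  · rw [monomial_mul_of_not_disjoint hd]
    exact T.zero_mem

theorem pivotCoeff_mul_monomial_mem {T : Submodule K (Grassmann K)} {n k : ℕ} {B : Finset ℕ}
    (h : Disjoint (coeffLetters n k) B → monomial K (coeffLetters n k ∪ B) ∈ T) :
    pivotCoeff K n k * monomial K B ∈ T := by
  obtain ⟨ε, hε⟩ := exists_pivotCoeff (K := K) n k
  rw [hε, smul_mul_assoc]
  exact units_smul_mem ε (monomial_mul_mem h)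

theorem pivot_monomial_mem {T : Submodule K (Grassmann K)} {n : ℕ} {B : Finset ℕ}
    (h : ∀ k, n + 3 * k ∈ B →
      monomial K (coeffLetters n k ∪ B.erase (n + 3 * k)) ∈ T) :
    pivot K n (monomial K B) ∈ T := by
  obtain ⟨N, hN⟩ := exists_pivot_eq_sum (monomial K B)
  rw [hN n N le_rfl]
  refine T.sum_mem fun k _ => ?_
  by_cases hk : n + 3 * k ∈ B
  · obtain ⟨ε, hε⟩ := exists_partialD_monomial (K := K) hk
    rw [hε, mul_smul_comm]
    exact units_smul_mem ε (pivotCoeff_mul_monomial_mem fun _ => h k hk)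
  · rw [partialD_monomial_of_notMem hk, mul_zero]
    exact T.zero_mem

/-! ### Homogeneity -/

theorem zmod_two_eq_zero_or_one : ∀ x : ZMod 2, x = 0 ∨ x = 1 := by decide

theorem letter_mem_parityPart (i : ℕ) : letter K i ∈ parityPart K 1 :=
  CliffordAlgebra.ι_mem_evenOdd_one _ _

theorem mul_mem_parityPart {α β : ZMod 2} {f g : Grassmann K} (hf : f ∈ parityPart K α)
    (hg : g ∈ parityPart K β) : f * g ∈ parityPart K (α + β) :=
  CliffordAlgebra.evenOdd_mul_le (0 : QuadraticForm K (ℕ →₀ K)) α β (Submodule.mul_mem_mul hf hg)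

theorem one_mem_parityPart : (1 : Grassmann K) ∈ parityPart K 0 :=
  Submodule.one_le.mp (CliffordAlgebra.one_le_evenOdd_zero (0 : QuadraticForm K (ℕ →₀ K)))

theorem monomial_mem_parityPart (A : Finset ℕ) : monomial K A ∈ parityPart K A.card := by
  have h (l : List ℕ) : (l.map (letter K)).prod ∈ parityPart K l.length := by
    induction l with
    | nil => simpa using one_mem_parityPart
    | cons i l ih =>
      rw [List.map_cons, List.prod_cons, List.length_cons, Nat.cast_succ, add_comm]
      exact mul_mem_parityPart (letter_mem_parityPart i) ih
  simpa [monomial] using h (A.sort (· ≤ ·))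

theorem partialD_mem_parityPart (i : ℕ) {β : ZMod 2} {f : Grassmann K}
    (hf : f ∈ parityPart K β) : partialD K i f ∈ parityPart K (1 + β) := by
  have hβ : ∀ β : ZMod 2, 1 + (1 + β) = β := by decide
  have step (β : ZMod 2) (v : ℕ →₀ K) (x : Grassmann K) (hx : x ∈ parityPart K β)
      (h : partialD K i x ∈ parityPart K (1 + β)) :
      partialD K i (CliffordAlgebra.ι _ v * x) ∈ parityPart K (1 + (1 + β)) := by
    rw [partialD, CliffordAlgebra.contractLeft_ι_mul]
    refine Submodule.sub_mem _ (Submodule.smul_mem _ _ ?_)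
      (mul_mem_parityPart (CliffordAlgebra.ι_mem_evenOdd_one _ _) h)
    rwa [hβ]
  unfold parityPart at hf
  induction f, hf using CliffordAlgebra.evenOdd_induction with
  | range_ι_pow v h =>
    rcases zmod_two_eq_zero_or_one β with rfl | rfl
    · obtain ⟨r, rfl⟩ := Submodule.mem_one.mp h
      rw [partialD, CliffordAlgebra.contractLeft_algebraMap]
      exact Submodule.zero_mem _
    · rw [ZMod.val_one, pow_one] at h
      obtain ⟨w, rfl⟩ := h
      have h := step 0 w 1 one_mem_parityPart (by
        rw [partialD, CliffordAlgebra.contractLeft_one]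
        exact Submodule.zero_mem _)
      rwa [mul_one, add_zero] at h
  | add x y hx hy ihx ihy =>
    rw [map_add]
    exact Submodule.add_mem _ ihx ihy
  | ι_mul_ι_mul v w x hx ih =>
    have hw := step β w x hx ih
    have hx' : CliffordAlgebra.ι _ w * x ∈ parityPart K (1 + β) :=
      mul_mem_parityPart (CliffordAlgebra.ι_mem_evenOdd_one _ _) hx
    have hv := step (1 + β) v _ hx' hw
    rwa [hβ, ← mul_assoc] at hv

theorem pivotCoeff_mem_parityPart (n k : ℕ) : pivotCoeff K n k ∈ parityPart K 0 := by
  induction k with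
  | zero => exact one_mem_parityPart
  | succ k ih =>
    have h := mul_mem_parityPart ih (mul_mem_parityPart (letter_mem_parityPart (K := K)
      (n + 3 * k)) (letter_mem_parityPart (n + 3 * k + 1)))
    have e : (0 + (1 + 1) : ZMod 2) = 0 := by decide
    rwa [e] at h

theorem isHomogeneous_pivot (n : ℕ) : IsHomogeneous K 1 (pivot K n) := by
  intro β f hf
  obtain ⟨N, hN⟩ := exists_pivot_eq_sum f
  rw [hN n N le_rfl]
  refine Submodule.sum_mem _ fun k _ => ?_
  have h := mul_mem_parityPart (pivotCoeff_mem_parityPart n k)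
    (partialD_mem_parityPart (n + 3 * k) hf)
  rwa [zero_add] at h

theorem isHomogeneous_lieMonomial (p : Finset ℕ × ℕ) :
    IsHomogeneous K (p.1.card + 1) (lieMonomial K p) := by
  intro β f hf
  rw [add_assoc]
  exact mul_mem_parityPart (monomial_mem_parityPart p.1) (isHomogeneous_pivot _ _ _ hf)

/-- An operator that is both even and odd vanishes. -/
theorem IsHomogeneous.eq_zero {a : Module.End K (Grassmann K)} (h0 : IsHomogeneous K 0 a)
    (h1 : IsHomogeneous K 1 a) : a = 0 := by
  have hc : IsCompl (parityPart K 0) (parityPart K 1) := CliffordAlgebra.evenOdd_isCompl _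
  have h2 (β : ZMod 2) (f) (hf : f ∈ parityPart K β) : a f = 0 := by
    have e0 := h0 β f hf
    have e1 := h1 β f hf
    fin_cases β
    · exact Submodule.disjoint_def.mp hc.disjoint _ e0 e1
    · exact Submodule.disjoint_def.mp hc.disjoint _ e1 e0
  refine LinearMap.ext fun f => ?_
  have hf : f ∈ parityPart K 0 ⊔ parityPart K 1 := by
    rw [hc.sup_eq_top]
    exact Submodule.mem_top
  obtain ⟨f₀, hf₀, f₁, hf₁, rfl⟩ := Submodule.mem_sup.mp hf
  rw [map_add, h2 0 f₀ hf₀, h2 1 f₁ hf₁, add_zero, LinearMap.zero_apply]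

/-- The homogeneous operators of given parity. -/
def homogeneousPart (K : Type*) [Field K] (α : ZMod 2) :
    Submodule K (Module.End K (Grassmann K)) where
  carrier := {a | IsHomogeneous K α a}
  zero_mem' _ _ _ := Submodule.zero_mem _
  add_mem' ha hb β f hf := Submodule.add_mem _ (ha β f hf) (hb β f hf)
  smul_mem' c _ ha β f hf := Submodule.smul_mem _ c (ha β f hf)

theorem IsHomogeneous.sub {α : ZMod 2} {a b : Module.End K (Grassmann K)}
    (ha : IsHomogeneous K α a) (hb : IsHomogeneous K α b) : IsHomogeneous K α (a - b) :=
  (homogeneousPart K α).sub_mem ha hb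

/-- The span of the monomials with indices in `I`. -/
def monomialSpan (K : Type*) [Field K] (I : Set (Finset ℕ × ℕ)) :
    Submodule K (Module.End K (Grassmann K)) :=
  Submodule.span K (lieMonomial K '' I)

theorem lieMonomial_mem_monomialSpan {I : Set (Finset ℕ × ℕ)} {p : Finset ℕ × ℕ} (h : p ∈ I) :
    lieMonomial K p ∈ monomialSpan K I :=
  Submodule.subset_span ⟨p, h, rfl⟩

/-- The indices of the monomials of parity `α`. -/
def parityIndices (α : ZMod 2) : Set (Finset ℕ × ℕ) := {p | (p.1.card + 1 : ZMod 2) = α}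

theorem monomialSpan_mono {I J : Set (Finset ℕ × ℕ)} (h : I ⊆ J) :
    monomialSpan K I ≤ monomialSpan K J :=
  Submodule.span_mono (Set.image_mono h)

theorem isHomogeneous_of_mem_monomialSpan {I : Set (Finset ℕ × ℕ)} {α : ZMod 2}
    {a : Module.End K (Grassmann K)} (h : a ∈ monomialSpan K (I ∩ parityIndices α)) :
    IsHomogeneous K α a := by
  have h' : monomialSpan K (I ∩ parityIndices α) ≤ homogeneousPart K α := by
    rw [monomialSpan, Submodule.span_le]
    rintro _ ⟨p, ⟨-, rfl⟩, rfl⟩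
    exact isHomogeneous_lieMonomial p
  exact h' h

theorem exists_eq_add_of_mem_monomialSpan {I : Set (Finset ℕ × ℕ)}
    {a : Module.End K (Grassmann K)} (h : a ∈ monomialSpan K I) :
    ∃ a₀ ∈ monomialSpan K (I ∩ parityIndices 0), ∃ a₁ ∈ monomialSpan K (I ∩ parityIndices 1),
      a = a₀ + a₁ := by
  have hI : I = (I ∩ parityIndices 0) ∪ (I ∩ parityIndices 1) := by
    ext p
    simp only [Set.mem_union, Set.mem_inter_iff, parityIndices, Set.mem_ofPred_eq]
    have := zmod_two_eq_zero_or_one (p.1.card + 1)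
    tauto
  rw [hI, monomialSpan, Set.image_union, Submodule.span_union] at h
  obtain ⟨a₀, h₀, a₁, h₁, rfl⟩ := Submodule.mem_sup.mp h
  exact ⟨a₀, h₀, a₁, h₁, rfl⟩

theorem mem_monomialSpan_of_isHomogeneous {I : Set (Finset ℕ × ℕ)} {α : ZMod 2}
    {a : Module.End K (Grassmann K)} (h : a ∈ monomialSpan K I) (ha : IsHomogeneous K α a) :
    a ∈ monomialSpan K (I ∩ parityIndices α) := by
  obtain ⟨a₀, h₀, a₁, h₁, rfl⟩ := exists_eq_add_of_mem_monomialSpan h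
  have e₀ := isHomogeneous_of_mem_monomialSpan h₀
  have e₁ := isHomogeneous_of_mem_monomialSpan h₁
  have hα : α = 0 ∨ α = 1 := zmod_two_eq_zero_or_one α
  rcases hα with rfl | rfl
  · have : a₁ = 0 := IsHomogeneous.eq_zero
      (by simpa [add_sub_cancel_left] using ha.sub e₀) e₁
    simpa [this] using h₀
  · have : a₀ = 0 := IsHomogeneous.eq_zero e₀
      (by simpa [add_sub_cancel_right] using ha.sub e₁)
    simpa [this] using h₁

/-- A span of monomials is closed under the supercommutator as soon as it contains the
supercommutators of its monomials. -/
theorem superBracket_mem_monomialSpan {I : Set (Finset ℕ × ℕ)}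
    (hI : ∀ p ∈ I, ∀ q ∈ I, superBracket (p.1.card + 1) (q.1.card + 1)
      (lieMonomial K p) (lieMonomial K q) ∈ monomialSpan K I)
    {α β : ZMod 2} {a b : Module.End K (Grassmann K)} (ha : a ∈ monomialSpan K I)
    (hb : b ∈ monomialSpan K I) (hα : IsHomogeneous K α a) (hβ : IsHomogeneous K β b) :
    superBracket α β a b ∈ monomialSpan K I := by
  have ha' := mem_monomialSpan_of_isHomogeneous ha hα
  have hb' := mem_monomialSpan_of_isHomogeneous hb hβ
  clear ha hb hα hβ
  unfold monomialSpan at ha' hb'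
  induction ha', hb' using Submodule.span_induction₂ with
  | mem_mem x y hx hy =>
    obtain ⟨p, ⟨hp, rfl⟩, rfl⟩ := hx
    obtain ⟨q, ⟨hq, rfl⟩, rfl⟩ := hy
    exact hI p hp q hq
  | zero_left y hy => simp [superBracket]
  | zero_right x hx => simp [superBracket]
  | add_left x y z hx hy hz h1 h2 =>
    convert Submodule.add_mem _ h1 h2 using 1
    simp only [superBracket, add_mul, mul_add, smul_add]; abel
  | add_right x y z hx hy hz h1 h2 =>
    convert Submodule.add_mem _ h1 h2 using 1
    simp only [superBracket, add_mul, mul_add, smul_add]; abel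
  | smul_left r x y hx hy h =>
    convert Submodule.smul_mem _ r h using 1
    simp only [superBracket, smul_mul_assoc, mul_smul_comm, smul_sub, smul_comm r]
  | smul_right r x y hx hy h =>
    convert Submodule.smul_mem _ r h using 1
    simp only [superBracket, smul_mul_assoc, mul_smul_comm, smul_sub, smul_comm r]

/-! ### Supercommutators of monomials -/

/-- The operator `f v_n`, linear in `f`. -/
def mulPivot (n : ℕ) : Grassmann K →ₗ[K] Module.End K (Grassmann K) where
  toFun f := LinearMap.mulLeft K f ∘ₗ pivot K n
  map_add' f g := by ext; simp [add_mul]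
  map_smul' c f := by ext; simp

theorem mulPivot_apply (n : ℕ) (f g : Grassmann K) : mulPivot n f g = f * pivot K n g := rfl

theorem lieMonomial_eq (A : Finset ℕ) (n : ℕ) :
    lieMonomial K (A, n) = mulPivot n (monomial K A) := rfl

theorem lieMonomial_empty (n : ℕ) : lieMonomial K (∅, n) = pivot K n := by
  ext f
  simp [lieMonomial]

/-- The anticommutator of two pivot elements, which is their supercommutator. -/
def anticomm (K : Type*) [Field K] (n m : ℕ) : Module.End K (Grassmann K) :=
  pivot K n * pivot K m + pivot K m * pivot K n

theorem neg_one_pow_smul {M : Type*} [AddCommGroup M] [Module K M] (k : ℕ) (x : M) :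
    (-1 : K) ^ k • x = (-1 : ℤˣ) ^ k • x := by
  rcases Nat.even_or_odd k with h | h
  · simp [h.neg_one_pow]
  · simp [h.neg_one_pow, Units.smul_def]

theorem neg_one_pow_val_mul_val (a b : ℕ) :
    (-1 : K) ^ ((a : ZMod 2).val * (b : ZMod 2).val) = (-1) ^ (a * b) := by
  apply neg_one_pow_congr
  simp [ZMod.val_natCast, Nat.even_iff]

/-- The supercommutator of two monomials, up to signs. -/
theorem exists_superBracket_lieMonomial (A B : Finset ℕ) (n m : ℕ) : ∃ ε δ : ℤˣ,
    superBracket (A.card + 1) (B.card + 1) (lieMonomial K (A, n)) (lieMonomial K (B, m)) =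
      mulPivot m (monomial K A * pivot K n (monomial K B)) +
        ε • mulPivot n (monomial K B * pivot K m (monomial K A)) +
        δ • (LinearMap.mulLeft K (monomial K A * monomial K B) * anticomm K n m) := by
  refine ⟨(-1) ^ ((A.card + 1) * (B.card + 1) + 1), (-1) ^ B.card, ?_⟩
  have e := neg_one_pow_val_mul_val (K := K) (A.card + 1) (B.card + 1)
  push_cast at e
  rw [superBracket, e, ← neg_one_pow_smul (K := K), ← neg_one_pow_smul (K := K)]
  have h : (-1 : K) ^ ((A.card + 1) * (B.card + 1)) * (-1) ^ A.card * (-1) ^ (B.card * A.card) =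
      -(-1) ^ B.card := by
    rw [← pow_add, ← pow_add, ← neg_one_mul ((-1 : K) ^ _), ← pow_succ']
    apply neg_one_pow_congr
    simp only [Nat.even_add, Nat.even_mul, Nat.even_add_one]
    tauto
  rw [pow_succ, mul_neg_one]
  generalize (-1 : K) ^ ((A.card + 1) * (B.card + 1)) = s at h ⊢
  refine LinearMap.ext fun f => ?_
  simp only [LinearMap.sub_apply, LinearMap.add_apply, LinearMap.smul_apply,
    Module.End.mul_apply, lieMonomial_eq, mulPivot_apply, pivot_mul, LinearMap.mulLeft_apply,
    anticomm, involute_monomial, mul_add, smul_add, smul_mul_assoc, mul_smul_comm, ← mul_assoc,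
    smul_smul, monomial_mul_comm B A]
  rw [h]
  simp only [neg_smul]
  abel

/-! ### Combinatorics of standard monomials -/

theorem mem_standardFirst {A : Finset ℕ} {n : ℕ} : (A, n) ∈ standardFirst ↔
    (∀ i ∈ A, i + 3 ≤ n) ∧ (n = 4 → 0 ∉ A) ∧ (n = 7 → ¬(0 ∈ A ∧ 3 ∈ A)) := by
  simp only [standardFirst, falseFirst, Set.mem_sdiff, Set.mem_union, Set.mem_ofPred_eq, not_or]
  constructor
  · rintro ⟨h, h4, h7⟩
    refine ⟨h, fun e h0 => h4 ⟨e, fun i hi => ?_, h0⟩, fun e h0 => h7 ⟨e, fun i hi => ?_, h0⟩⟩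
    all_goals
      have := h i hi
      rw [Finset.mem_range]
      omega
  · rintro ⟨h, h4, h7⟩
    exact ⟨h, fun h' => h4 h'.1 h'.2.2, fun h' => h7 h'.1 h'.2.2⟩

theorem mem_standardSecond {A : Finset ℕ} {n : ℕ} : (A, n) ∈ standardSecond ↔
    3 ≤ n ∧ n - 2 ∈ A ∧ (∀ i ∈ A, i = n - 2 ∨ i + 5 ≤ n) ∧ (n = 5 → 0 ∉ A) ∧
      (n = 7 → 0 ∉ A) ∧ (n = 10 → ¬(0 ∈ A ∧ 3 ∈ A ∧ 5 ∈ A)) := by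
  simp only [standardSecond, falseSecond, Set.mem_sdiff, Set.mem_union, Set.mem_ofPred_eq, not_or,
    Set.mem_insert_iff, Set.mem_singleton_iff, Prod.mk.injEq]
  constructor
  · rintro ((⟨rfl, rfl⟩ | ⟨rfl, rfl⟩ | ⟨rfl, rfl⟩) | ⟨⟨hn, B, hB, rfl⟩, h7, h10⟩)
    · simp
    · simp
    · simp
    · refine ⟨by omega, Finset.mem_insert_self _ _, fun i hi => ?_, by omega, ?_, ?_⟩
      · exact (Finset.mem_insert.mp hi).imp_right (hB i)
      · rintro rfl h0
        refine h7 ⟨rfl, B, fun i hi => ?_, by simpa using h0, rfl⟩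
        have := hB i hi
        rw [Finset.mem_range]
        omega
      · rintro rfl ⟨h0, h3, h5⟩
        refine h10 ⟨rfl, B, fun i hi => ?_, by simpa using h0, by simpa using h3,
          by simpa using h5, rfl⟩
        have := hB i hi
        rw [Finset.mem_range]
        omega
  · rintro ⟨hn, hm, h, h5, h7, h10⟩
    by_cases h6 : 6 ≤ n
    · refine Or.inr ⟨⟨h6, A.erase (n - 2), fun i hi => ?_, (Finset.insert_erase hm).symm⟩, ?_, ?_⟩
      · rw [Finset.mem_erase] at hi
        exact (h i hi.2).resolve_left hi.1
      · rintro ⟨e, B, -, h0, rfl⟩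
        exact h7 e (Finset.mem_insert_of_mem h0)
      · rintro ⟨e, B, -, k0, k3, k5, rfl⟩
        exact h10 e ⟨Finset.mem_insert_of_mem k0, Finset.mem_insert_of_mem k3,
          Finset.mem_insert_of_mem k5⟩
    · have hA : A = {n - 2} := by
        refine Finset.eq_singleton_iff_unique_mem.mpr ⟨hm, fun i hi => ?_⟩
        refine (h i hi).resolve_right fun h' => ?_
        have : i = 0 := by omega
        subst this
        exact h5 (by omega) hi
      subst hA
      interval_cases n <;> simp

theorem mem_pivotSquares {A : Finset ℕ} {n : ℕ} :
    (A, n) ∈ pivotSquares ↔ 3 ≤ n ∧ A = {n - 2} := Iff.rfl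

theorem pivotSquares_subset : pivotSquares ⊆ standardSecond := by
  rintro ⟨A, n⟩ ⟨hn, hA⟩
  obtain rfl : A = {n - 2} := hA
  refine mem_standardSecond.mpr ⟨hn, by simp, by simp, ?_, ?_, ?_⟩ <;> simp <;> omega

/-- The conditions on an index `(A, n)` shared by the standard monomials of both types that are
needed for the closure under supercommutators. -/
structure IsTame (A : Finset ℕ) (n : ℕ) : Prop where
  add_two_le : ∀ i ∈ A, i + 2 ≤ n ∧ 3 ≤ n
  four : n = 4 → 0 ∉ A
  five : n = 5 → 0 ∈ A → 3 ∉ A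
  seven : n = 7 → 0 ∈ A → 3 ∉ A
  seven_five : n = 7 → 5 ∈ A → 0 ∉ A ∧ 3 ∉ A

theorem isTame_of_mem {A : Finset ℕ} {n : ℕ} (h : (A, n) ∈ standardFirst ∪ standardSecond) :
    IsTame A n := by
  rcases h with h | h
  · obtain ⟨h, h4, h7⟩ := mem_standardFirst.mp h
    refine ⟨fun i hi => ?_, h4, fun e _ h3 => ?_, fun e h0 h3 => h7 e ⟨h0, h3⟩, fun e h5 => ?_⟩
    · have := h i hi
      omega
    · have := h 3 h3
      omega
    · have := h 5 h5
      omega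
  · obtain ⟨hn, hm, h, h5, h7, h10⟩ := mem_standardSecond.mp h
    refine ⟨fun i hi => ?_, ?_, fun e h0 _ => h5 e h0, fun e h0 _ => h7 e h0,
      fun e _ => ⟨h7 e, fun h3 => ?_⟩⟩
    · have := h i hi
      omega
    · rintro rfl h0
      have := h 0 h0
      omega
    · have := h 3 h3
      omega

variable {A B : Finset ℕ} {n m k : ℕ}

/-- The tails occurring in `x^A v_n(x^B) v_m`, for `x^B v_m` of the first type. -/
theorem derivative_mem_standardFirst (hA : IsTame A n) (hB : (B, m) ∈ standardFirst)
    (hk : n + 3 * k ∈ B) :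
    (A ∪ (coeffLetters n k ∪ B.erase (n + 3 * k)), m) ∈ standardFirst := by
  obtain ⟨h, h4, h7⟩ := mem_standardFirst.mp hB
  obtain ⟨a, a4, a5, a7, a75⟩ := hA
  have := h _ hk
  have a0 := a 0
  have a3 := a 3
  rw [mem_standardFirst]
  simp only [Finset.mem_union, Finset.mem_erase, mem_coeffLetters]
  refine ⟨?_, ?_, ?_⟩
  · rintro i (hi | ⟨l, hl, hi⟩ | hi)
    · have := a i hi
      omega
    · omega
    · exact h i hi.2
  · rintro rfl (hi | ⟨l, hl, hi⟩ | hi)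
    · have := a0 hi
      omega
    · omega
    · exact h4 rfl hi.2
  · rintro rfl ⟨h0 | ⟨l, hl, h0⟩ | h0, h3 | ⟨l', hl', h3⟩ | h3⟩
    all_goals grind

/-- Differentiating the letter `x_{m-2}` of a monomial of the second type with pivot element `v_m`
results in the first type. -/
theorem derivative_top_mem_standardFirst (hA : IsTame A n) (hB : (B, m) ∈ standardSecond)
    (hk : n + 3 * k = m - 2) :
    (A ∪ (coeffLetters n k ∪ B.erase (n + 3 * k)), m) ∈ standardFirst := by
  obtain ⟨hm, -, h, h5, h7, h10⟩ := mem_standardSecond.mp hB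
  obtain ⟨a, a4, a5, a7, a75⟩ := hA
  have a0 := a 0
  have a3 := a 3
  have h0 := h 0
  have h3 := h 3
  rw [mem_standardFirst]
  simp only [Finset.mem_union, Finset.mem_erase, mem_coeffLetters]
  refine ⟨?_, ?_, ?_⟩
  · rintro i (hi | ⟨l, hl, hi⟩ | hi)
    · have := a i hi
      omega
    · omega
    · have := h i hi.2
      omega
  · rintro rfl (hi | ⟨l, hl, hi⟩ | hi)
    · have := a0 hi
      omega
    · omega
    · have := h0 hi.2
      omega
  · rintro rfl ⟨h0 | ⟨l, hl, h0⟩ | h0, h3 | ⟨l', hl', h3⟩ | h3⟩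
    all_goals grind

/-- Differentiating any other letter of a monomial of the second type preserves the type. -/
theorem derivative_mem_standardSecond (hA : IsTame A n) (hB : (B, m) ∈ standardSecond)
    (hk : n + 3 * k ∈ B) (hne : n + 3 * k ≠ m - 2) :
    (A ∪ (coeffLetters n k ∪ B.erase (n + 3 * k)), m) ∈ standardSecond := by
  obtain ⟨hm, hm', h, h5, h7, h10⟩ := mem_standardSecond.mp hB
  obtain ⟨a, a4, a5, a7, a75⟩ := hA
  have := (h _ hk).resolve_left hne
  rw [mem_standardSecond]
  simp only [Finset.mem_union, Finset.mem_erase, mem_coeffLetters]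
  refine ⟨hm, Or.inr (Or.inr ⟨hne.symm, hm'⟩), ?_, ?_, ?_, ?_⟩
  · rintro i (hi | ⟨l, hl, hi⟩ | hi)
    · have := a i hi
      omega
    · omega
    · exact h i hi.2
  · rintro rfl -
    exact h5 rfl (by convert hk using 1; omega)
  · rintro rfl (hi | ⟨l, hl, hi⟩ | hi)
    · have := a 0 hi
      omega
    · omega
    · exact h7 rfl hi.2
  · rintro rfl ⟨h0 | ⟨l, hl, h0⟩ | h0, h3 | ⟨l', hl', h3⟩ | h3, hh5 | ⟨l', hl', hh5⟩ | hh5⟩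
    all_goals grind

theorem anticomm_one_mem_standardFirst (hA : IsTame A n) (hB : IsTame B (n + 3 * k + 1)) :
    (A ∪ B ∪ (coeffLetters n k ∪ {n + 3 * k}), n + 3 * k + 3) ∈ standardFirst := by
  obtain ⟨a, a4, a5, a7, a75⟩ := hA
  obtain ⟨b, b4, b5, b7, b75⟩ := hB
  rw [mem_standardFirst]
  simp only [Finset.mem_union, Finset.mem_singleton, mem_coeffLetters]
  refine ⟨?_, ?_, ?_⟩
  · rintro i ((hi | hi) | ⟨l, hl, hi⟩ | hi)
    · have := a i hi
      omega
    · have := b i hi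
      omega
    · omega
    · omega
  · rintro h ((hi | hi) | ⟨l, hl, hi⟩ | hi)
    · have := a 0 hi
      omega
    · have := b 0 hi
      omega
    · omega
    · omega
  · rintro h ⟨(h0 | h0) | ⟨l, hl, h0⟩ | h0, (h3 | h3) | ⟨l', hl', h3⟩ | h3⟩
    all_goals grind

theorem anticomm_two_mem_standardFirst (hA : IsTame A n) (hB : IsTame B (n + 3 * k + 2)) :
    (A ∪ B ∪ (coeffLetters n k ∪ {n + 3 * k, n + 3 * k + 1, n + 3 * k + 2}), n + 3 * k + 5) ∈
      standardFirst := by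
  obtain ⟨a, a4, a5, a7, a75⟩ := hA
  obtain ⟨b, b4, b5, b7, b75⟩ := hB
  rw [mem_standardFirst]
  simp only [Finset.mem_union, Finset.mem_singleton, Finset.mem_insert, mem_coeffLetters]
  refine ⟨?_, by omega, ?_⟩
  · rintro i ((hi | hi) | ⟨l, hl, hi⟩ | hi)
    · have := a i hi
      omega
    · have := b i hi
      omega
    · omega
    · omega
  · rintro h ⟨(h0 | h0) | ⟨l, hl, h0⟩ | h0, -⟩
    · have := a 0 h0
      omega
    · exact b4 (by omega) h0
    · omega
    · omega

theorem anticomm_zero_mem_standardSecond (hA : IsTame A n) (hB : IsTame B (n + 3 * k)) :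
    (A ∪ B ∪ (coeffLetters n k ∪ {n + 3 * k + 1}), n + 3 * k + 3) ∈ standardSecond := by
  obtain ⟨a, a4, a5, a7, a75⟩ := hA
  obtain ⟨b, b4, b5, b7, b75⟩ := hB
  rw [mem_standardSecond]
  simp only [Finset.mem_union, Finset.mem_singleton, mem_coeffLetters]
  refine ⟨by omega, by right; right; omega, ?_, ?_, ?_, ?_⟩
  · rintro i ((hi | hi) | ⟨l, hl, hi⟩ | hi)
    · have := a i hi
      omega
    · have := b i hi
      omega
    · omega
    · omega
  · rintro h ((hi | hi) | ⟨l, hl, hi⟩ | hi)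
    · have := a 0 hi
      omega
    · have := b 0 hi
      omega
    · omega
    · omega
  · rintro h ((hi | hi) | ⟨l, hl, hi⟩ | hi)
    · have := a 0 hi
      grind
    · exact b4 (by omega) hi
    · omega
    · omega
  · rintro h ⟨h0, h3, h5⟩
    have h0' : 0 ∈ A ∨ 0 ∈ B := by grind
    have h3' : 3 ∈ A ∨ 3 ∈ B := by grind
    have hn : n = 7 ∧ k = 0 ∨ n = 4 ∨ n = 1 := by omega
    rcases hn with ⟨rfl, rfl⟩ | rfl | rfl
    all_goals grind

variable {S : Submodule K (Module.End K (Grassmann K))}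

/-! ### Closure of the spans of standard monomials -/

theorem mulPivot_derivative_mem
    (h : ∀ k, n + 3 * k ∈ B →
      lieMonomial K (A ∪ (coeffLetters n k ∪ B.erase (n + 3 * k)), m) ∈ S) :
    mulPivot m (monomial K A * pivot K n (monomial K B)) ∈ S :=
  pivot_monomial_mem (T := (S.comap (mulPivot m)).comap (LinearMap.mulLeft K (monomial K A)))
    fun k hk => monomial_mul_mem (T := S.comap (mulPivot m)) fun _ => h k hk

theorem monomial_mul_mul_mem {T : Submodule K (Grassmann K)} (D : Finset ℕ)
    (h : monomial K (A ∪ B ∪ (coeffLetters n k ∪ D)) ∈ T) :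
    monomial K A * monomial K B * (pivotCoeff K n k * monomial K D) ∈ T := by
  by_cases hd : Disjoint A B
  · obtain ⟨ε, hε⟩ := exists_monomial_mul (K := K) hd
    rw [hε, smul_mul_assoc]
    refine units_smul_mem ε ?_
    exact pivotCoeff_mul_monomial_mem
      (T := T.comap (LinearMap.mulLeft K (monomial K (A ∪ B)))) fun _ => monomial_mul_mem fun _ => h
  · rw [monomial_mul_of_not_disjoint hd, zero_mul]
    exact T.zero_mem

theorem monomial_triple (n : ℕ) : ∃ ε : ℤˣ,
    letter K n * letter K (n + 1) * letter K (n + 2) = ε • monomial K {n, n + 1, n + 2} := by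
  obtain ⟨ε, hε⟩ := exists_letter_mul_letter (K := K) (i := n + 1) (j := n + 2) (by omega)
  obtain ⟨δ, hδ⟩ := exists_monomial_mul (K := K) (A := {n}) (B := {n + 1, n + 2}) (by simp)
  rw [monomial_singleton, ← Finset.insert_eq] at hδ
  refine ⟨ε * δ, ?_⟩
  rw [mul_assoc, hε, mul_smul_comm, hδ, smul_smul]

theorem anticomm_comm (n m : ℕ) : anticomm K n m = anticomm K m n := add_comm _ _

theorem anticomm_add_zero (n k : ℕ) : anticomm K n (n + 3 * k) =
    (2 : K) • mulPivot (n + 3 * k + 3) (pivotCoeff K n k * monomial K {n + 3 * k + 1}) := by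
  refine LinearMap.ext fun f => ?_
  refine (anticomm_pivot_add_mul n k 0 f _ rfl).trans ?_
  rw [add_zero, pivot_pivot, LinearMap.smul_apply, mulPivot_apply, monomial_singleton, ← two_smul K,
    mul_smul_comm, mul_assoc]

theorem anticomm_add_one (n k : ℕ) : anticomm K n (n + 3 * k + 1) =
    -mulPivot (n + 3 * k + 3) (pivotCoeff K n k * monomial K {n + 3 * k}) := by
  refine LinearMap.ext fun f => ?_
  refine (anticomm_pivot_add_mul n k 1 f _ (anticomm_pivot_succ _ f)).trans ?_
  rw [LinearMap.neg_apply, mulPivot_apply, monomial_singleton, mul_neg, mul_assoc]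

theorem anticomm_add_two (n k : ℕ) : ∃ ε : ℤˣ, anticomm K n (n + 3 * k + 2) =
    ε • mulPivot (n + 3 * k + 5)
      (pivotCoeff K n k * monomial K {n + 3 * k, n + 3 * k + 1, n + 3 * k + 2}) := by
  obtain ⟨ε, hε⟩ := monomial_triple (K := K) (n + 3 * k)
  refine ⟨-ε, LinearMap.ext fun f => ?_⟩
  refine (anticomm_pivot_add_mul n k 2 f _ (anticomm_pivot_add_two _ f)).trans ?_
  rw [hε, LinearMap.smul_apply, mulPivot_apply, smul_mul_assoc, mul_neg, mul_smul_comm,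
    Units.neg_smul, mul_assoc]

theorem mulLeft_mul_mulPivot (f g : Grassmann K) (n : ℕ) :
    LinearMap.mulLeft K f * mulPivot n g = mulPivot n (f * g) := by
  refine LinearMap.ext fun h => ?_
  simp [mulPivot_apply, mul_assoc]

theorem smul_mulPivot_mem (c : K) {N : ℕ} {D : Finset ℕ}
    (h : c • lieMonomial K (A ∪ B ∪ (coeffLetters n k ∪ D), N) ∈ S) :
    c • mulPivot N (monomial K A * monomial K B * (pivotCoeff K n k * monomial K D)) ∈ S := by
  have hT : monomial K (A ∪ B ∪ (coeffLetters n k ∪ D)) ∈ S.comap (c • mulPivot N) := h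
  exact monomial_mul_mul_mem D hT

theorem mulLeft_mul_anticomm_mem_of_le (h1 : ∀ p ∈ standardFirst, lieMonomial K p ∈ S)
    (h2 : ∀ p ∈ standardSecond, (2 : K) • lieMonomial K p ∈ S) (hA : IsTame A n) (hB : IsTame B m)
    (hnm : n ≤ m) : LinearMap.mulLeft K (monomial K A * monomial K B) * anticomm K n m ∈ S := by
  have hm : m = n + 3 * ((m - n) / 3) ∨ m = n + 3 * ((m - n) / 3) + 1 ∨
      m = n + 3 * ((m - n) / 3) + 2 := by omega
  generalize (m - n) / 3 = k at hm
  rcases hm with rfl | rfl | rfl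
  · rw [anticomm_add_zero, mul_smul_comm, mulLeft_mul_mulPivot]
    exact smul_mulPivot_mem _ (h2 _ (anticomm_zero_mem_standardSecond hA hB))
  · rw [anticomm_add_one, mul_neg, mulLeft_mul_mulPivot, ← neg_one_smul K]
    exact smul_mulPivot_mem _ (S.smul_mem _ (h1 _ (anticomm_one_mem_standardFirst hA hB)))
  · obtain ⟨ε, hε⟩ := anticomm_add_two (K := K) n k
    rw [hε, mul_smul_comm, mulLeft_mul_mulPivot, Units.smul_def, ← Int.cast_smul_eq_zsmul K]
    exact smul_mulPivot_mem _ (S.smul_mem _ (h1 _ (anticomm_two_mem_standardFirst hA hB)))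

theorem mulLeft_mul_anticomm_mem (h1 : ∀ p ∈ standardFirst, lieMonomial K p ∈ S)
    (h2 : ∀ p ∈ standardSecond, (2 : K) • lieMonomial K p ∈ S) (hA : IsTame A n)
    (hB : IsTame B m) :
    LinearMap.mulLeft K (monomial K A * monomial K B) * anticomm K n m ∈ S := by
  rcases le_total n m with h | h
  · exact mulLeft_mul_anticomm_mem_of_le h1 h2 hA hB h
  · have e : LinearMap.mulLeft K (monomial K A * monomial K B) =
        (-1 : K) ^ (A.card * B.card) • LinearMap.mulLeft K (monomial K B * monomial K A) := by
      rw [monomial_mul_comm A B]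
      refine LinearMap.ext fun f => ?_
      simp only [LinearMap.mulLeft_apply, LinearMap.smul_apply, smul_mul_assoc]
    rw [anticomm_comm, e, smul_mul_assoc]
    exact S.smul_mem _ (mulLeft_mul_anticomm_mem_of_le h1 h2 hB hA h)

/-- The supercommutators of monomials with indices in `I` belong to the span of these monomials,
if `I` consists of all standard monomials of the first type and some of the second type, is closed
under the action on tails, and the doubled standard monomials of the second type lie in the
span. -/
theorem superBracket_lieMonomial_mem {I : Set (Finset ℕ × ℕ)} (h1 : standardFirst ⊆ I)
    (hI : I ⊆ standardFirst ∪ standardSecond)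
    (h2 : ∀ p ∈ standardSecond, (2 : K) • lieMonomial K p ∈ monomialSpan K I)
    (hd : ∀ A n B m k, IsTame A n → (B, m) ∈ I → n + 3 * k ∈ B →
      (A ∪ (coeffLetters n k ∪ B.erase (n + 3 * k)), m) ∈ I) :
    ∀ p ∈ I, ∀ q ∈ I, superBracket (p.1.card + 1) (q.1.card + 1)
      (lieMonomial K p) (lieMonomial K q) ∈ monomialSpan K I := by
  rintro ⟨A, n⟩ hp ⟨B, m⟩ hq
  have hA := isTame_of_mem (hI hp)
  have hB := isTame_of_mem (hI hq)
  obtain ⟨ε, δ, h⟩ := exists_superBracket_lieMonomial (K := K) A B n m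
  rw [h]
  refine Submodule.add_mem _ (Submodule.add_mem _ ?_ (units_smul_mem ε ?_)) (units_smul_mem δ ?_)
  · exact mulPivot_derivative_mem fun k hk =>
      lieMonomial_mem_monomialSpan (hd A n B m k hA hq hk)
  · exact mulPivot_derivative_mem fun k hk =>
      lieMonomial_mem_monomialSpan (hd B m A n k hB hp hk)
  · exact mulLeft_mul_anticomm_mem (fun p hp => lieMonomial_mem_monomialSpan (h1 hp)) h2 hA hB

theorem derivative_mem_standard (hA : IsTame A n)
    (hB : (B, m) ∈ standardFirst ∪ standardSecond) (hk : n + 3 * k ∈ B) :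
    (A ∪ (coeffLetters n k ∪ B.erase (n + 3 * k)), m) ∈ standardFirst ∪ standardSecond := by
  rcases hB with hB | hB
  · exact Or.inl (derivative_mem_standardFirst hA hB hk)
  · by_cases h : n + 3 * k = m - 2
    · exact Or.inl (derivative_top_mem_standardFirst hA hB h)
    · exact Or.inr (derivative_mem_standardSecond hA hB hk h)

theorem derivative_mem_standardFirst_union_pivotSquares (hA : IsTame A n)
    (hB : (B, m) ∈ standardFirst ∪ pivotSquares) (hk : n + 3 * k ∈ B) :
    (A ∪ (coeffLetters n k ∪ B.erase (n + 3 * k)), m) ∈ standardFirst ∪ pivotSquares := by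
  rcases hB with hB | hB
  · exact Or.inl (derivative_mem_standardFirst hA hB hk)
  · obtain ⟨-, rfl⟩ := mem_pivotSquares.mp hB
    exact Or.inl (derivative_top_mem_standardFirst hA (pivotSquares_subset hB)
      (Finset.mem_singleton.mp hk))

/-! ### Characteristic two -/

section CharTwo

variable [CharP K 2]

/-- In characteristic two, the supercommutator is the commutator for all parities. -/
theorem superBracket_eq_lie (α β : ZMod 2) (a b : Module.End K (Grassmann K)) :
    superBracket α β a b = ⁅a, b⁆ := by
  rw [superBracket, CharTwo.neg_eq, one_pow, one_smul, LieRing.of_associative_ring_bracket]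

theorem superBracket_lieMonomial_mem_charTwo {I : Set (Finset ℕ × ℕ)} (h1 : standardFirst ⊆ I)
    (hI : I ⊆ standardFirst ∪ standardSecond)
    (hd : ∀ A n B m k, IsTame A n → (B, m) ∈ I → n + 3 * k ∈ B →
      (A ∪ (coeffLetters n k ∪ B.erase (n + 3 * k)), m) ∈ I) :
    ∀ p ∈ I, ∀ q ∈ I, superBracket (p.1.card + 1) (q.1.card + 1)
      (lieMonomial K p) (lieMonomial K q) ∈ monomialSpan K I :=
  superBracket_lieMonomial_mem h1 hI (fun p _ => by
    rw [CharTwo.two_eq_zero, zero_smul]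
    exact Submodule.zero_mem _) hd

theorem lie_mem_monomialSpan {I : Set (Finset ℕ × ℕ)}
    (hI : ∀ p ∈ I, ∀ q ∈ I, superBracket (p.1.card + 1) (q.1.card + 1)
      (lieMonomial K p) (lieMonomial K q) ∈ monomialSpan K I)
    {a b : Module.End K (Grassmann K)} (ha : a ∈ monomialSpan K I)
    (hb : b ∈ monomialSpan K I) : ⁅a, b⁆ ∈ monomialSpan K I := by
  refine LinearMap.BilinMap.apply_apply_mem_of_mem_span (monomialSpan K I) _ _
    (LieAlgebra.ad K (Module.End K (Grassmann K))).toLinearMap ?_ a b ha hb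
  rintro _ ⟨p, hp, rfl⟩ _ ⟨q, hq, rfl⟩
  have h := hI p hp q hq
  rwa [superBracket_eq_lie] at h

/-- In characteristic two, `(a + b)² = a² + b² + [a, b]`, so that a span of monomials closed under
commutators is closed under squares as soon as it contains the squares of its monomials. -/
theorem mul_self_mem_monomialSpan {I : Set (Finset ℕ × ℕ)}
    (hI : ∀ p ∈ I, lieMonomial K p * lieMonomial K p ∈ monomialSpan K I)
    (hlie : ∀ a ∈ monomialSpan K I, ∀ b ∈ monomialSpan K I, ⁅a, b⁆ ∈ monomialSpan K I)
    {a : Module.End K (Grassmann K)} (ha : a ∈ monomialSpan K I) :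
    a * a ∈ monomialSpan K I := by
  have ha' := ha
  unfold monomialSpan at ha'
  induction ha' using Submodule.span_induction with
  | mem x hx =>
    obtain ⟨p, hp, rfl⟩ := hx
    exact hI p hp
  | zero =>
    rw [zero_mul]
    exact Submodule.zero_mem _
  | add x y hx hy ihx ihy =>
    have e : (x + y) * (x + y) = x * x + y * y + ⁅x, y⁆ := by
      have h2 : (2 : K) • (y * x) = 0 := by rw [CharTwo.two_eq_zero, zero_smul]
      rw [two_smul] at h2
      rw [LieRing.of_associative_ring_bracket, sub_eq_add_neg, neg_eq_of_add_eq_zero_left h2,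
        add_mul, mul_add, mul_add]
      abel
    rw [e]
    exact Submodule.add_mem _ (Submodule.add_mem _ (ihx hx) (ihy hy)) (hlie x hx y hy)
  | smul c x hx ih =>
    rw [smul_mul_smul_comm]
    exact Submodule.smul_mem _ _ (ih hx)

end CharTwo

theorem pivot_mul_self (n : ℕ) :
    pivot K n * pivot K n = lieMonomial K ({n + 1}, n + 3) := by
  refine LinearMap.ext fun f => ?_
  simp [lieMonomial, pivot_pivot]

/-- A monomial with nonempty tail preceding its pivot element squares to zero. -/
theorem lieMonomial_mul_self (hA : ∀ i ∈ A, i < n) (hne : A.Nonempty) :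
    lieMonomial K (A, n) * lieMonomial K (A, n) = 0 := by
  have h : monomial K A * monomial K A = 0 := monomial_mul_of_not_disjoint
    (by rwa [disjoint_self, Finset.bot_eq_empty, ← ne_eq, ← Finset.nonempty_iff_ne_empty])
  refine LinearMap.ext fun f => ?_
  rw [Module.End.mul_apply, lieMonomial_eq, mulPivot_apply, mulPivot_apply, pivot_mul,
    pivot_monomial_of_lt hA, involute_monomial, zero_mul, zero_add, ← mul_assoc, mul_smul_comm, h,
    smul_zero, zero_mul, LinearMap.zero_apply]

theorem lieMonomial_mul_self_mem {p : Finset ℕ × ℕ} (hp : p ∈ standardFirst ∪ pivotSquares) :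
    lieMonomial K p * lieMonomial K p ∈ monomialSpan K (standardFirst ∪ pivotSquares) := by
  obtain ⟨A, n⟩ := p
  rcases A.eq_empty_or_nonempty with rfl | hne
  · rw [lieMonomial_empty, pivot_mul_self]
    exact lieMonomial_mem_monomialSpan (Or.inr ⟨by simp, by simp⟩)
  · rw [lieMonomial_mul_self (fun i hi => ?_) hne]
    · exact Submodule.zero_mem _
    · have := (isTame_of_mem (Set.union_subset_union_right _ pivotSquares_subset hp)).add_two_le i hi
      omega

/-! ### Generation of the standard monomials -/

/-- A subspace that contains `v_0, v_1, v_2` and the supercommutators of any two of its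
monomials. -/
structure IsBracketClosed (S : Submodule K (Module.End K (Grassmann K))) : Prop where
  generators_subset : generators K ⊆ S
  bracket_mem : ∀ p q, lieMonomial K p ∈ S → lieMonomial K q ∈ S →
    superBracket (p.1.card + 1) (q.1.card + 1) (lieMonomial K p) (lieMonomial K q) ∈ S

theorem mem_of_units_smul_mem {M : Type*} [AddCommGroup M] [Module K M] {T : Submodule K M} {f : M}
    {ε : ℤˣ} (hf : ε • f ∈ T) : f ∈ T := by
  have h := units_smul_mem ε⁻¹ hf
  rwa [inv_smul_smul] at h

theorem monomial_union_mem {T : Submodule K (Grassmann K)} {D : Finset ℕ}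
    (hAB : Disjoint A B) (hD : Disjoint (A ∪ B) D)
    (h : monomial K A * monomial K B * monomial K D ∈ T) : monomial K (A ∪ B ∪ D) ∈ T := by
  obtain ⟨ε, hε⟩ := exists_monomial_mul (K := K) hAB
  obtain ⟨δ, hδ⟩ := exists_monomial_mul (K := K) hD
  rw [hε, smul_mul_assoc, hδ, smul_smul] at h
  exact mem_of_units_smul_mem h

namespace IsBracketClosed

/-- If all letters of the two tails precede both pivot elements, the supercommutator of two
monomials reduces to the anticommutator of the pivot elements. -/
theorem mulLeft_mul_anticomm_mem (hS : IsBracketClosed S) (hA : ∀ i ∈ A, i < n)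
    (hB : ∀ i ∈ B, i < n) (hnm : n ≤ m) (hAS : lieMonomial K (A, n) ∈ S)
    (hBS : lieMonomial K (B, m) ∈ S) :
    LinearMap.mulLeft K (monomial K A * monomial K B) * anticomm K n m ∈ S := by
  obtain ⟨ε, δ, h⟩ := exists_superBracket_lieMonomial (K := K) A B n m
  have h' := hS.bracket_mem _ _ hAS hBS
  rw [h, pivot_monomial_of_lt hB, pivot_monomial_of_lt fun i hi => (hA i hi).trans_le hnm] at h'
  simp only [mul_zero, map_zero, smul_zero, zero_add] at h'
  exact mem_of_units_smul_mem h'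

theorem lieMonomial_union_one (hS : IsBracketClosed S) (hAB : Disjoint A B) (hA : ∀ i ∈ A, i < n)
    (hB : ∀ i ∈ B, i < n) (hAS : lieMonomial K (A, n) ∈ S)
    (hBS : lieMonomial K (B, n + 1) ∈ S) : lieMonomial K (A ∪ B ∪ {n}, n + 3) ∈ S := by
  have h := hS.mulLeft_mul_anticomm_mem hA hB (by omega) hAS hBS
  have e := anticomm_add_one (K := K) n 0
  simp only [pivotCoeff, one_mul, mul_zero, add_zero] at e
  rw [e, mul_neg, mulLeft_mul_mulPivot, S.neg_mem_iff] at h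
  refine monomial_union_mem (T := S.comap (mulPivot (n + 3))) hAB ?_ h
  rw [Finset.disjoint_singleton_right, Finset.mem_union]
  rintro (hi | hi)
  · exact (hA n hi).false
  · exact (hB n hi).false

theorem lieMonomial_union_two (hS : IsBracketClosed S) (hAB : Disjoint A B) (hA : ∀ i ∈ A, i < n)
    (hB : ∀ i ∈ B, i < n) (hAS : lieMonomial K (A, n) ∈ S)
    (hBS : lieMonomial K (B, n + 2) ∈ S) :
    lieMonomial K (A ∪ B ∪ {n, n + 1, n + 2}, n + 5) ∈ S := by
  have h := hS.mulLeft_mul_anticomm_mem hA hB (by omega) hAS hBS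
  obtain ⟨ε, hε⟩ := anticomm_add_two (K := K) n 0
  simp only [pivotCoeff, one_mul, mul_zero, add_zero] at hε
  rw [hε, mul_smul_comm, mulLeft_mul_mulPivot] at h
  have h := mem_of_units_smul_mem h
  refine monomial_union_mem (T := S.comap (mulPivot (n + 5))) hAB ?_ h
  rw [Finset.disjoint_left]
  intro i hi
  have : i < n := (Finset.mem_union.mp hi).elim (hA i) (hB i)
  simp only [Finset.mem_insert, Finset.mem_singleton]
  omega

theorem lieMonomial_union_zero (hS : IsBracketClosed S) (h2 : (2 : K) ≠ 0) (hAB : Disjoint A B)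
    (hA : ∀ i ∈ A, i < n) (hB : ∀ i ∈ B, i < n) (hAS : lieMonomial K (A, n) ∈ S)
    (hBS : lieMonomial K (B, n) ∈ S) : lieMonomial K (A ∪ B ∪ {n + 1}, n + 3) ∈ S := by
  have h := hS.mulLeft_mul_anticomm_mem hA hB le_rfl hAS hBS
  have e := anticomm_add_zero (K := K) n 0
  rw [mul_zero, add_zero] at e
  rw [e, mul_smul_comm, mulLeft_mul_mulPivot, S.smul_mem_iff h2] at h
  simp only [pivotCoeff, one_mul] at h
  refine monomial_union_mem (T := S.comap (mulPivot (n + 3))) hAB ?_ h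
  rw [Finset.disjoint_singleton_right, Finset.mem_union]
  rintro (hi | hi)
  · exact absurd (hA _ hi) (by omega)
  · exact absurd (hB _ hi) (by omega)

/-- The coefficients of `{v_j, v_m}`, `j < m`, are divisible by `x_j`. -/
theorem letter_mul_anticomm {j : ℕ} (h : j < m) (f : Grassmann K) :
    letter K j * anticomm K j m f = 0 := by
  have e : letter K j * (letter K j * letter K (j + 1)) = 0 := by
    rw [← mul_assoc, letter_mul_self, zero_mul]
  refine (congrArg (letter K j * ·) (anticomm_pivot_step h f)).trans ?_
  rw [mul_add, ← mul_assoc, e, zero_mul, zero_add, pivot_mul, pivot_letter_of_lt h, zero_mul,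
    zero_add, involute_letter, neg_mul, neg_mul, mul_neg, ← mul_assoc, ← mul_assoc,
    letter_mul_self, zero_mul, zero_mul, neg_zero]

/-- A letter `x_j` can be removed from a tail by the supercommutator with `v_j`. -/
theorem lieMonomial_erase (hS : IsBracketClosed S) {j : ℕ} (hj : j ∈ A) (hjm : j < m)
    (hjS : pivot K j ∈ S) (hAS : lieMonomial K (A, m) ∈ S) :
    lieMonomial K (A.erase j, m) ∈ S := by
  rw [← lieMonomial_empty] at hjS
  obtain ⟨ε, δ, h⟩ := exists_superBracket_lieMonomial (K := K) ∅ A j m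
  have h' := hS.bracket_mem _ _ hjS hAS
  have h0 : LinearMap.mulLeft K (monomial K A) * anticomm K j m = 0 := by
    obtain ⟨η, hη⟩ := exists_monomial_eq_letter_mul (K := K) hj
    refine LinearMap.ext fun f => ?_
    rw [Module.End.mul_apply, LinearMap.mulLeft_apply, hη, letter_mul, smul_mul_assoc, mul_assoc,
      letter_mul_anticomm hjm, mul_zero, smul_zero, LinearMap.zero_apply]
  obtain ⟨η, hη⟩ := exists_pivot_monomial (K := K) hj
  simp only [h, monomial_empty, one_mul, pivot_one, mul_zero, map_zero, smul_zero, add_zero, h0,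
    hη] at h'
  rw [Units.smul_def, map_zsmul, ← Units.smul_def] at h'
  exact mem_of_units_smul_mem h'

/-- All pivot elements are obtained: `[v_n, v_{n+1}] = -x_n v_{n+3}`, and `v_n` removes `x_n`. -/
theorem pivot_mem (hS : IsBracketClosed S) (n : ℕ) : pivot K n ∈ S := by
  induction n using Nat.strong_induction_on with
  | h n ih =>
    match n, ih with
    | 0, _ => exact hS.generators_subset (by simp [generators])
    | 1, _ => exact hS.generators_subset (by simp [generators])
    | 2, _ => exact hS.generators_subset (by simp [generators])
    | n + 3, ih =>
      have h := hS.lieMonomial_union_one (A := ∅) (B := ∅) (n := n) (by simp) (by simp) (by simp)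
        (by rw [lieMonomial_empty]; exact ih n (by omega))
        (by rw [lieMonomial_empty]; exact ih (n + 1) (by omega))
      have h' := hS.lieMonomial_erase (j := n) (by simp) (by omega) (ih n (by omega)) h
      simpa [lieMonomial_empty] using h'

theorem lieMonomial_empty_mem (hS : IsBracketClosed S) (n : ℕ) : lieMonomial K (∅, n) ∈ S := by
  rw [lieMonomial_empty]
  exact hS.pivot_mem n

theorem lieMonomial_of_subset (hS : IsBracketClosed S) (hA : ∀ i ∈ A, i < m)
    (hAS : lieMonomial K (A, m) ∈ S) (hBA : B ⊆ A) : lieMonomial K (B, m) ∈ S := by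
  have key (D : Finset ℕ) (hD : D ⊆ A) : lieMonomial K (A \ D, m) ∈ S := by
    induction D using Finset.induction_on with
    | empty => simpa using hAS
    | insert j D hj ih =>
      have hjA : j ∈ A := hD (Finset.mem_insert_self j D)
      have e : A \ insert j D = (A \ D).erase j := by
        ext i
        simp only [Finset.mem_sdiff, Finset.mem_insert, Finset.mem_erase]
        tauto
      rw [e]
      exact hS.lieMonomial_erase (Finset.mem_sdiff.mpr ⟨hjA, hj⟩) (hA j hjA) (hS.pivot_mem j)
        (ih fun i hi => hD (Finset.mem_insert_of_mem hi))
  have h := key (A \ B) Finset.sdiff_subset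
  rwa [Finset.sdiff_sdiff_eq_self hBA] at h

/-- The complete tails: `x_0 x_1 ⋯ x_{n-3} v_n` is obtained for `n ≠ 4, 7`. The case `n = 10`
avoids the missing monomial with `n = 7` by distributing the letters over two factors. -/
theorem lieMonomial_range (hS : IsBracketClosed S) (n : ℕ) (h4 : n ≠ 4) (h7 : n ≠ 7) :
    lieMonomial K (Finset.range (n - 2), n) ∈ S := by
  induction n using Nat.strong_induction_on with
  | h n ih =>
    rcases Nat.lt_or_ge n 3 with hn | hn
    · rw [show n - 2 = 0 by omega, Finset.range_zero]
      exact hS.lieMonomial_empty_mem n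
    by_cases h3 : n = 3
    · subst h3
      exact hS.lieMonomial_union_one (A := ∅) (B := ∅) (n := 0) (by simp) (by simp) (by simp)
        (hS.lieMonomial_empty_mem _) (hS.lieMonomial_empty_mem _)
    by_cases h10 : n = 10
    · subst h10
      have h5 : lieMonomial K ({0}, 5) ∈ S :=
        hS.lieMonomial_of_subset (by decide) (ih 5 (by omega) (by omega) (by omega))
          (by simp)
      have h4 : lieMonomial K ({1}, 4) ∈ S :=
        hS.lieMonomial_union_one (A := ∅) (B := ∅) (n := 1) (by simp) (by simp) (by simp)
        (hS.lieMonomial_empty_mem _) (hS.lieMonomial_empty_mem _)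
      have h7 : lieMonomial K ({1, 2, 3, 4}, 7) ∈ S := by
        have e : ({1, 2, 3, 4} : Finset ℕ) = ∅ ∪ {1} ∪ {2, 2 + 1, 2 + 2} := by decide
        rw [e]
        exact hS.lieMonomial_union_two (by simp) (by simp) (by simp)
          (hS.lieMonomial_empty_mem _) h4
      have e : Finset.range (10 - 2) = {0} ∪ {1, 2, 3, 4} ∪ {5, 5 + 1, 5 + 2} := by decide
      rw [e]
      exact hS.lieMonomial_union_two (by decide) (by simp) (by simp) h5 h7
    obtain ⟨n, rfl⟩ : ∃ l, n = l + 5 := ⟨n - 5, by omega⟩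
    have h := ih (n + 2) (by omega) (by omega) (by omega)
    convert hS.lieMonomial_union_two (A := ∅) (n := n) (by simp) (by simp) (by simp)
      (hS.lieMonomial_empty_mem _) h using 3
    ext i
    simp only [Finset.mem_range, Finset.mem_union, Finset.mem_insert, Finset.mem_singleton,
      Finset.notMem_empty, false_or]
    omega

theorem lieMonomial_mem_of_mem_standardFirst (hS : IsBracketClosed S) {p : Finset ℕ × ℕ}
    (hp : p ∈ standardFirst) : lieMonomial K p ∈ S := by
  obtain ⟨A, n⟩ := p
  obtain ⟨h, h4, h7⟩ := mem_standardFirst.mp hp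
  have hr (l : ℕ) : ∀ i ∈ Finset.range (l - 2), i < l := fun i hi => by
    rw [Finset.mem_range] at hi
    omega
  have m4 : lieMonomial K ({1}, 4) ∈ S :=
    hS.lieMonomial_union_one (A := ∅) (B := ∅) (n := 1) (by simp) (by simp) (by simp)
      (hS.lieMonomial_empty_mem _) (hS.lieMonomial_empty_mem _)
  by_cases e4 : n = 4
  · subst e4
    refine hS.lieMonomial_of_subset (by simp) m4 fun i hi => ?_
    have := h i hi
    have : i ≠ 0 := fun e => h4 rfl (e ▸ hi)
    rw [Finset.mem_singleton]
    omega
  by_cases e7 : n = 7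
  · subst e7
    by_cases h0 : 0 ∈ A
    · have m7 := hS.lieMonomial_union_one (A := ∅) (n := 4) (by simp) (by simp) (by decide)
        (hS.lieMonomial_empty_mem _) (hS.lieMonomial_range 5 (by omega) (by omega))
      refine hS.lieMonomial_of_subset (by decide) m7 fun i hi => ?_
      have := h i hi
      have : i ≠ 3 := fun e => h7 rfl ⟨h0, e ▸ hi⟩
      simp only [Finset.mem_range, Finset.mem_union, Finset.mem_singleton,
        Finset.notMem_empty, false_or]
      omega
    · have m7 := hS.lieMonomial_union_two (A := ∅) (n := 2) (by simp) (by simp) (by simp)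
        (hS.lieMonomial_empty_mem _) m4
      refine hS.lieMonomial_of_subset (by simp) m7 fun i hi => ?_
      have := h i hi
      have : i ≠ 0 := fun e => h0 (e ▸ hi)
      simp only [Finset.mem_union, Finset.mem_insert, Finset.mem_singleton,
        Finset.notMem_empty, false_or]
      omega
  refine hS.lieMonomial_of_subset (hr n) (hS.lieMonomial_range n e4 e7) fun i hi => ?_
  have := h i hi
  rw [Finset.mem_range]
  omega

theorem lieMonomial_mem_of_mem_standardSecond (hS : IsBracketClosed S) (h2 : (2 : K) ≠ 0)
    {p : Finset ℕ × ℕ} (hp : p ∈ standardSecond) : lieMonomial K p ∈ S := by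
  obtain ⟨A, n⟩ := p
  obtain ⟨hn, hm, h, h5, h7, h10⟩ := mem_standardSecond.mp hp
  obtain ⟨n, rfl⟩ : ∃ l, n = l + 3 := ⟨n - 3, by omega⟩
  have hm : n + 1 ∈ A := hm
  have hsq (l : ℕ) : lieMonomial K ({l + 1}, l + 3) ∈ S :=
    hS.lieMonomial_union_zero (A := ∅) (B := ∅) (n := l) h2 (by simp) (by simp) (by simp)
      (hS.lieMonomial_empty_mem _) (hS.lieMonomial_empty_mem _)
  obtain ⟨E, hE, rfl⟩ : ∃ E, n + 1 ∉ E ∧ A = E ∪ {n + 1} :=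
    ⟨A.erase (n + 1), by simp, by rw [Finset.union_comm, ← Finset.insert_eq,
      Finset.insert_erase hm]⟩
  have hEn (i : ℕ) (hi : i ∈ E) : i + 2 ≤ n := by
    have := h i (Finset.mem_union_left _ hi)
    have : i ≠ n + 1 := fun e => hE (e ▸ hi)
    omega
  -- It suffices to distribute the letters of `E` over two monomials with pivot element `v_n`.
  suffices ∃ C D, Disjoint C D ∧ E = C ∪ D ∧ lieMonomial K (C, n) ∈ S ∧
      lieMonomial K (D, n) ∈ S by
    obtain ⟨C, D, hCD, rfl, hC, hD⟩ := this
    refine hS.lieMonomial_union_zero h2 hCD (fun i hi => ?_) (fun i hi => ?_) hC hD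
    · have := hEn i (Finset.mem_union_left _ hi)
      omega
    · have := hEn i (Finset.mem_union_right _ hi)
      omega
  have h5' : n = 2 → 0 ∉ E := fun e h0 => h5 (by omega) (Finset.mem_union_left _ h0)
  have h7' : n = 4 → 0 ∉ E := fun e h0 => h7 (by omega) (Finset.mem_union_left _ h0)
  have h10' : n = 7 → 0 ∈ E → 3 ∈ E → 5 ∉ E := fun e k0 k3 k5 => h10 (by omega)
    ⟨Finset.mem_union_left _ k0, Finset.mem_union_left _ k3, Finset.mem_union_left _ k5⟩
  -- The letter `x_{n-2}` is put into a factor of its own, the square of `v_{n-3}`.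
  by_cases ht : n - 2 ∈ E
  · have hn3 : 3 ≤ n := by
      have h1 := hEn _ ht
      by_contra hlt
      have h0 : n - 2 = 0 := by omega
      exact h5' (by omega) (h0 ▸ ht)
    refine ⟨E.erase (n - 2), {n - 2}, by simp, ?_, ?_, ?_⟩
    · rw [Finset.union_comm, ← Finset.insert_eq, Finset.insert_erase ht]
    · refine hS.lieMonomial_mem_of_mem_standardFirst (mem_standardFirst.mpr
        ⟨fun i hi => ?_, ?_, ?_⟩)
      · have := hEn i (Finset.mem_of_mem_erase hi)
        have := Finset.ne_of_mem_erase hi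
        omega
      · exact fun e h0 => h7' e (Finset.mem_of_mem_erase h0)
      · rintro rfl ⟨k0, k3⟩
        exact h10' rfl (Finset.mem_of_mem_erase k0) (Finset.mem_of_mem_erase k3) ht
    · obtain ⟨l, rfl⟩ : ∃ l, n = l + 3 := ⟨n - 3, by omega⟩
      exact hsq l
  have hEn' (i : ℕ) (hi : i ∈ E) : i + 3 ≤ n := by
    have := hEn i hi
    have : i ≠ n - 2 := fun e => ht (e ▸ hi)
    omega
  -- If `n = 7`, the letters `x_0` and `x_3` must not occur in the same factor.
  by_cases h03 : n = 7 ∧ 0 ∈ E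
  · obtain ⟨rfl, k0⟩ := h03
    refine ⟨{0}, E.erase 0, by simp, ?_, ?_, ?_⟩
    · rw [← Finset.insert_eq, Finset.insert_erase k0]
    · exact hS.lieMonomial_mem_of_mem_standardFirst (mem_standardFirst.mpr (by simp))
    · exact hS.lieMonomial_mem_of_mem_standardFirst (mem_standardFirst.mpr
        ⟨fun i hi => hEn' i (Finset.mem_of_mem_erase hi), by simp, by simp⟩)
  · refine ⟨E, ∅, by simp, by simp, ?_, hS.lieMonomial_empty_mem n⟩
    exact hS.lieMonomial_mem_of_mem_standardFirst (mem_standardFirst.mpr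
      ⟨hEn', h7', fun e k => h03 ⟨e, k.1⟩⟩)

end IsBracketClosed

/-! ### The bases -/

theorem generators_subset_monomialSpan {I : Set (Finset ℕ × ℕ)} (h : standardFirst ⊆ I) :
    generators K ⊆ monomialSpan K I := by
  have h' (n : ℕ) : pivot K n ∈ monomialSpan K I := by
    rw [← lieMonomial_empty]
    exact lieMonomial_mem_monomialSpan (h (mem_standardFirst.mpr (by simp)))
  rintro _ (rfl | rfl | rfl) <;> exact h' _

theorem monomialSpan_le {I : Set (Finset ℕ × ℕ)} (h : ∀ p ∈ I, lieMonomial K p ∈ S) :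
    monomialSpan K I ≤ S := by
  rw [monomialSpan, Submodule.span_le]
  rintro _ ⟨p, hp, rfl⟩
  exact h p hp

theorem exists_homogeneous_components {I : Set (Finset ℕ × ℕ)} {a : Module.End K (Grassmann K)}
    (ha : a ∈ monomialSpan K I) : ∃ a₀ ∈ monomialSpan K I, ∃ a₁ ∈ monomialSpan K I,
      IsHomogeneous K 0 a₀ ∧ IsHomogeneous K 1 a₁ ∧ a = a₀ + a₁ := by
  obtain ⟨a₀, h₀, a₁, h₁, rfl⟩ := exists_eq_add_of_mem_monomialSpan ha
  exact ⟨a₀, monomialSpan_mono Set.inter_subset_left h₀, a₁,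
    monomialSpan_mono Set.inter_subset_left h₁, isHomogeneous_of_mem_monomialSpan h₀,
    isHomogeneous_of_mem_monomialSpan h₁, rfl⟩

theorem IsLieSubsuperalgebra.isBracketClosed (hS : IsLieSubsuperalgebra S)
    (hg : generators K ⊆ S) : IsBracketClosed S :=
  ⟨hg, fun p q hp hq => hS.bracket _ _ _ hp _ hq (isHomogeneous_lieMonomial p)
    (isHomogeneous_lieMonomial q)⟩

theorem lieSuperQ_eq (h : ringChar K ≠ 2) :
    monomialSpan K (standardFirst ∪ standardSecond) = lieSuperQ K := by
  have h2 : (2 : K) ≠ 0 := Ring.two_ne_zero h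
  refine le_antisymm (le_sInf ?_) (sInf_le ⟨generators_subset_monomialSpan
    Set.subset_union_left, fun a ha => exists_homogeneous_components ha, ?_, fun h' => absurd h' h⟩)
  · rintro S ⟨hg, hS⟩
    have hc := hS.isBracketClosed hg
    exact monomialSpan_le fun p hp => hp.elim hc.lieMonomial_mem_of_mem_standardFirst
      (hc.lieMonomial_mem_of_mem_standardSecond h2)
  · intro α β a ha b hb hα hβ
    exact superBracket_mem_monomialSpan (superBracket_lieMonomial_mem Set.subset_union_left
      subset_rfl (fun p hp => Submodule.smul_mem _ _ (lieMonomial_mem_monomialSpan (Or.inr hp)))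
      fun _ _ _ _ _ => derivative_mem_standard) ha hb hα hβ

/-- A subspace that contains the generators, the supercommutators of its monomials and the squares of
its pivot elements contains the monomials of the first type and the squares of all pivot elements. -/
theorem monomialSpan_pivotSquares_le (hS : IsBracketClosed S)
    (hsq : ∀ n, pivot K n ∈ S → pivot K n * pivot K n ∈ S) :
    monomialSpan K (standardFirst ∪ pivotSquares) ≤ S := by
  refine monomialSpan_le fun p hp => hp.elim hS.lieMonomial_mem_of_mem_standardFirst ?_
  obtain ⟨A, n⟩ := p
  rintro ⟨hn, hA⟩
  obtain ⟨n, rfl⟩ : ∃ l, n = l + 3 := ⟨n - 3, by omega⟩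
  obtain rfl : A = {n + 1} := hA
  rw [← pivot_mul_self]
  exact hsq n (hS.pivot_mem n)

section CharTwo

variable [CharP K 2]

theorem IsBracketClosed.of_lie (hg : generators K ⊆ S)
    (hS : ∀ a ∈ S, ∀ b ∈ S, ⁅a, b⁆ ∈ S) : IsBracketClosed S :=
  ⟨hg, fun p q hp hq => by
    rw [superBracket_eq_lie]
    exact hS _ hp _ hq⟩

theorem lieQ_eq : monomialSpan K standardFirst = lieQ K := by
  have hlie : ∀ a ∈ monomialSpan K standardFirst, ∀ b ∈ monomialSpan K standardFirst,
      ⁅a, b⁆ ∈ monomialSpan K standardFirst := fun a ha b hb =>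
    lie_mem_monomialSpan (superBracket_lieMonomial_mem_charTwo subset_rfl Set.subset_union_left
      fun _ _ _ _ _ => derivative_mem_standardFirst) ha hb
  refine le_antisymm (monomialSpan_le fun p hp => ?_) ?_
  · refine (IsBracketClosed.of_lie LieSubalgebra.subset_lieSpan
      fun a ha b hb => ?_).lieMonomial_mem_of_mem_standardFirst hp
    exact LieSubalgebra.lie_mem _ ha hb
  · let L : LieSubalgebra K (Module.End K (Grassmann K)) :=
      { monomialSpan K standardFirst with lie_mem' := fun ha hb => hlie _ ha _ hb }
    have hL : LieSubalgebra.lieSpan K (Module.End K (Grassmann K)) (generators K) ≤ L :=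
      LieSubalgebra.lieSpan_le.mpr (generators_subset_monomialSpan (K := K) subset_rfl)
    exact hL

theorem lie_mem_monomialSpan_pivotSquares {a b : Module.End K (Grassmann K)}
    (ha : a ∈ monomialSpan K (standardFirst ∪ pivotSquares))
    (hb : b ∈ monomialSpan K (standardFirst ∪ pivotSquares)) :
    ⁅a, b⁆ ∈ monomialSpan K (standardFirst ∪ pivotSquares) :=
  lie_mem_monomialSpan (superBracket_lieMonomial_mem_charTwo Set.subset_union_left
    (Set.union_subset_union_right _ pivotSquares_subset)
    fun _ _ _ _ _ => derivative_mem_standardFirst_union_pivotSquares) ha hb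

theorem mul_self_mem_monomialSpan_pivotSquares {a : Module.End K (Grassmann K)}
    (ha : a ∈ monomialSpan K (standardFirst ∪ pivotSquares)) :
    a * a ∈ monomialSpan K (standardFirst ∪ pivotSquares) :=
  mul_self_mem_monomialSpan (fun _ => lieMonomial_mul_self_mem)
    (fun _ ha _ hb => lie_mem_monomialSpan_pivotSquares ha hb) ha

theorem isRestrictedLieSubsuperalgebra_monomialSpan :
    IsRestrictedLieSubsuperalgebra 2 (monomialSpan K (standardFirst ∪ pivotSquares)) where
  graded _ ha := exists_homogeneous_components ha
  bracket α β a ha b hb _ _ := by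
    rw [superBracket_eq_lie]
    exact lie_mem_monomialSpan_pivotSquares ha hb
  square _ _ ha _ := mul_self_mem_monomialSpan_pivotSquares ha
  pow_mem a ha _ := by
    rw [pow_two]
    exact mul_self_mem_monomialSpan_pivotSquares ha

theorem lieSuperQ_eq_of_charTwo (h : ringChar K = 2) :
    monomialSpan K (standardFirst ∪ pivotSquares) = lieSuperQ K := by
  refine le_antisymm (le_sInf ?_) (sInf_le ⟨generators_subset_monomialSpan
    Set.subset_union_left, isRestrictedLieSubsuperalgebra_monomialSpan.toIsLieSubsuperalgebra⟩)
  rintro S ⟨hg, hS⟩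
  exact monomialSpan_pivotSquares_le (hS.isBracketClosed hg)
    fun n hn => hS.square h _ hn (isHomogeneous_pivot n)

theorem restrictedLieSuperQ_eq (h : ringChar K = 2) :
    monomialSpan K (standardFirst ∪ pivotSquares) = restrictedLieSuperQ K 2 := by
  refine le_antisymm (le_sInf ?_) (sInf_le ⟨generators_subset_monomialSpan
    Set.subset_union_left, isRestrictedLieSubsuperalgebra_monomialSpan⟩)
  rintro S ⟨hg, hS⟩
  exact monomialSpan_pivotSquares_le (hS.isBracketClosed hg)
    fun n hn => hS.square h _ hn (isHomogeneous_pivot n)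

theorem restrictedLieQ_eq :
    monomialSpan K (standardFirst ∪ pivotSquares) = restrictedLieQ K 2 := by
  refine le_antisymm (le_sInf ?_) (sInf_le ⟨generators_subset_monomialSpan
    Set.subset_union_left, fun a ha b hb => lie_mem_monomialSpan_pivotSquares ha hb,
    fun a ha => ?_⟩)
  · rintro S ⟨hg, hS⟩
    refine monomialSpan_pivotSquares_le (IsBracketClosed.of_lie hg hS.lie_mem) fun n hn => ?_
    rw [← pow_two]
    exact hS.pow_mem _ hn
  · rw [pow_two]
    exact mul_self_mem_monomialSpan_pivotSquares ha

end CharTwo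

end

end FractalQ

theorem theorem5p1 (K : Type*) [Field K] :
    (ringChar K ≠ 2 →
      FractalQ.IsMonomialBasis K (FractalQ.standardFirst ∪ FractalQ.standardSecond)
        (FractalQ.lieSuperQ K)) ∧
    (ringChar K = 2 →
      FractalQ.IsMonomialBasis K FractalQ.standardFirst (FractalQ.lieQ K) ∧
      (∀ n : ℕ, 3 ≤ n →
        FractalQ.pivot K (n - 3) * FractalQ.pivot K (n - 3) =
          FractalQ.lieMonomial K ({n - 2}, n)) ∧
      FractalQ.IsMonomialBasis K (FractalQ.standardFirst ∪ FractalQ.pivotSquares)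
        (FractalQ.lieSuperQ K) ∧
      FractalQ.IsMonomialBasis K (FractalQ.standardFirst ∪ FractalQ.pivotSquares)
        (FractalQ.restrictedLieSuperQ K 2) ∧
      FractalQ.IsMonomialBasis K (FractalQ.standardFirst ∪ FractalQ.pivotSquares)
        (FractalQ.restrictedLieQ K 2)) := by
  refine ⟨fun h => FractalQ.isMonomialBasis_of_span_eq (FractalQ.lieSuperQ_eq h), fun h => ?_⟩
  have : CharP K 2 := ringChar.of_eq h
  refine ⟨FractalQ.isMonomialBasis_of_span_eq FractalQ.lieQ_eq, fun n hn => ?_,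
    FractalQ.isMonomialBasis_of_span_eq (FractalQ.lieSuperQ_eq_of_charTwo h),
    FractalQ.isMonomialBasis_of_span_eq (FractalQ.restrictedLieSuperQ_eq h),
    FractalQ.isMonomialBasis_of_span_eq FractalQ.restrictedLieQ_eq⟩
  obtain ⟨n, rfl⟩ : ∃ l, n = l + 3 := ⟨n - 3, by omega⟩
  exact FractalQ.pivot_mul_self n
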